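/- \textbf{Corollary (Using prior knowledge to refine estimates of large expectation values).} \emph{Setting.} Let $A=\sum_{j=0}^{J-1}A_j=\sum_{j=0}^{J-1}\sum_{k=1}^{n_j}\beta_{jk}\Pi_{jk}$ ($J\ge 1$) be an operator on $\mathbb{C}^{2^n}$, where the $\Pi_{jk}$ are orthogonal projectors, the $\beta_{jk}$ are real, and for every $j$ the numbers $\beta_{j1},\dots,\beta_{jn_j}$ are all non-negative or all non-positive. Write $\|\beta\|_{1,1/2}:=\sum_j\big(\sum_k\sqrt{|\beta_{jk}|}\big)^2$. For every $j$ let $I_j\subseteq[n_j]$ be a set of indices and let $T_j$ satisfy $[n_j]\setminus I_j\subseteq T_j\subseteq[n_j]$ (for instance $T_j=[n_j]$ or $T_j=[n_j]\setminus I_j$). \emph{Oracles.} A quantum algorithm has access to unitaries $O_\psi$, $\mathtt{PREPARE}_{\pi,j}$, $\mathtt{SELECT}_{\pi,j}$ and their inverses, where $O_\psi|0\rangle^{\otimes n}=|\psi\rangle$, \[ \mathtt{PREPARE}_{\pi,j}|0\rangle|0\rangle=\sum_{k\in T_j}\sum_{y\in\{0,1\}}\frac{|\beta_{jk}|^{1/4}}{\sqrt2\,\sqrt{\sum_{k'\in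 T_j}\sqrt{|\beta_{jk'}|}}}\,|k\rangle|y\rangle \] (no condition if $\beta_{jk}=0$ for all $k\in T_j$), and, for $k\in T_j$, $y\in\{0,1\}$, every $n$-qubit vector $|v\rangle$ and $l\in\{0,k\}$, with $R_{jk}=\mathbb{1}-2\Pi_{jk}$, \[ \mathtt{SELECT}_{\pi,j}|k\rangle|y\rangle|v\rangle|l\rangle=|k\rangle\, Z|y\rangle\,\big(R_{jk}^{\,y}\otimes(|0\rangle\langle k|+|k\rangle\langle 0|)\big)|v\rangle|l\rangle . \] On all other states these unitaries are arbitrary. Each use of one of them or of its inverse is one query; unitaries that do not depend on the oracles are free. \emph{Claim.} For every $c>0$ there is a constant $K>0$, depending only on $c$, such that the following holds. Let $n,J,(n_j),\beta,(I_j),(T_j)$ be as above, and let numbers $C_{j,i}$, integers $\mu_j\ge 1$, an error tolerance $\epsilon>0$ and a failure probability $\delta'\in(0,1)$ with $\delta'\le J/2$ be given. Put $P_0(j):=\sin^2\big(\pi/(2(2\mu_j+1))\big)$ and \[ \widetilde\epsilon_j:=\frac{\epsilon}{2\sum_{i\in I_j}|\beta_{j,i}|}\cdot\frac{\big(\sum_k\sqrt{|\beta_{jk}|}\big)^2}{\sum_{j'}\big(\sum_k\sqrt{|\beta_{j'k}|}\big)^2}.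 \] Then there is a quantum algorithm, which depends only on these data, such that for all projectors $\Pi_{jk}$, all states $|\psi\rangle$, all oracles as above and all real $\delta_j$ that satisfy \begin{itemize} \item $C_{j,i}>0$, $C_{j,i}\ge\widetilde\epsilon_j$ and $\big|C_{j,i}-\langle\psi|\Pi_{j,i}|\psi\rangle\big|\le\widetilde\epsilon_j$ for all $j$ and all $i\in I_j$ with $\beta_{j,i}\ne0$; \item for every $j$, $\delta_j\in[-P_0(j),0)$ and \[ P_{A'_j}:=\frac{\sum_{k\notin I_j}|\beta_{jk}|\,\langle\psi|\Pi_{jk}|\psi\rangle}{\big(\sum_{k\notin I_j}\sqrt{|\beta_{jk}|}\big)^2}=P_0(j)+\delta_j \] (where $P_{A'_j}:=0$ if $\beta_{jk}=0$ for all $k\notin I_j$); \item $\epsilon\le c\,\|\beta\|_{1,1/2}\min_j\{P_0(j)^2/|\delta_j|\}$, \end{itemize} the algorithm outputs a number within $\epsilon$ of $\langle\psi|A|\psi\rangle$ with probability at least $1-\delta'$, and its total number of queries (to $\mathtt{SELECT}_\pi$, $\mathtt{PREPARE}_\pi$ and $O_\psi$ together) is at most \[ K\cdot\frac{\big(\sum_j\sqrt{P_0(j)}\big)\,\|\beta\|_{1,1/2}\,\log(J/\delta')}{\epsilon}\,\max_j\frac{P_0(j)}{|\delta_j|}.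 \] -/

import Mathlib

open scoped Matrix Kronecker

noncomputable section

namespace AAE

/-! ### Quantum query algorithms

The oracles are a family of unitaries, the oracle `o` acting on a register with computational
basis `D o`.  A query algorithm is a fixed sequence of gates on a finite-dimensional space; the
oracle-independent gates are free, and every use of an oracle or of its inverse costs one query.
At the end, the whole space is measured in the computational basis and the outcome is turned
classically into a real number (intermediate measurements can be deferred to the end). -/

/-- A gate on the space with computational basis `Ω`: an oracle-independent unitary, or the
oracle `o` (or its inverse) applied to one tensor factor of a splitting `Ω ≃ D o × R`. -/
inductive Gate {ι : Type} (D : ι → Type) (Ω : Type) [Fintype Ω] [DecidableEq Ω] : Type 1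
  | free (U : Matrix.unitaryGroup Ω ℂ) : Gate D Ω
  | query (o : ι) (inverse : Bool) (R : Type) [DecidableEq R] (e : Ω ≃ D o × R) : Gate D Ω

/-- The operator that a gate performs when the oracles are `O`. -/
def Gate.toMatrix {ι : Type} {D : ι → Type} [∀ o, Fintype (D o)] [∀ o, DecidableEq (D o)]
    {Ω : Type} [Fintype Ω] [DecidableEq Ω] (O : ∀ o, Matrix.unitaryGroup (D o) ℂ) :
    Gate D Ω → Matrix Ω Ω ℂ
  | .free U => (U : Matrix Ω Ω ℂ)
  | @Gate.query _ _ _ _ _ o inverse R _ e =>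
      ((if inverse then (O o : Matrix (D o) (D o) ℂ)ᴴ else (O o : Matrix (D o) (D o) ℂ)) ⊗ₖ
        (1 : Matrix R R ℂ)).submatrix e e

/-- Whether a gate is a query. -/
def Gate.isQuery {ι : Type} {D : ι → Type} {Ω : Type} [Fintype Ω] [DecidableEq Ω] :
    Gate D Ω → Bool
  | .free _ => false
  | @Gate.query _ _ _ _ _ _ _ _ _ _ => true

/-- A quantum query algorithm with a real output: its space (with computational basis `Ω`), the
basis state it starts in, its gates in the order of application, and the classical
post-processing of the measured basis state. -/
structure QueryAlgorithm {ι : Type} (D : ι → Type) : Type 1 where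
  Ω : Type
  [fintypeΩ : Fintype Ω]
  [decidableEqΩ : DecidableEq Ω]
  init : Ω
  gates : List (Gate D Ω)
  output : Ω → ℝ

attribute [instance] QueryAlgorithm.fintypeΩ QueryAlgorithm.decidableEqΩ

/-- The state before the final measurement. -/
def QueryAlgorithm.finalState {ι : Type} {D : ι → Type} [∀ o, Fintype (D o)]
    [∀ o, DecidableEq (D o)] (𝒜 : QueryAlgorithm D) (O : ∀ o, Matrix.unitaryGroup (D o) ℂ) :
    𝒜.Ω → ℂ :=
  𝒜.gates.foldl (fun v g => g.toMatrix O *ᵥ v) (Pi.single 𝒜.init 1)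

open Classical in
/-- The probability (Born's rule) that the output of the algorithm lies in `S`. -/
def QueryAlgorithm.prob {ι : Type} {D : ι → Type} [∀ o, Fintype (D o)]
    [∀ o, DecidableEq (D o)] (𝒜 : QueryAlgorithm D) (O : ∀ o, Matrix.unitaryGroup (D o) ℂ)
    (S : Set ℝ) : ℝ :=
  ∑ ω with 𝒜.output ω ∈ S, ‖𝒜.finalState O ω‖ ^ 2

/-- The total number of queries, to all oracles and their inverses. -/
def QueryAlgorithm.numQueries {ι : Type} {D : ι → Type} (𝒜 : QueryAlgorithm D) : ℕ :=
  𝒜.gates.countP Gate.isQuery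

/-! ### The access model

The operator is `∑ j, ∑ k, β j k • Pr j k` on `n` qubits, `j : Fin J`, `k : Fin (m j)`.  Registers
that hold an index `k` of the `j`-th group have the basis `Fin (m j + 1)`, where `0` is the blank
symbol and `k.succ` stands for the index `k : Fin (m j)`. -/

/-- Computational basis states of `n` qubits; `0` is the all-zero string. -/
abbrev Qubits (n : ℕ) : Type := Fin n → Fin 2

/-- The oracles: state preparation, and `PREPARE`, `SELECT` for every group `j`. -/
inductive OracleName (J : ℕ) : Type
  | state : OracleName J
  | prepare (j : Fin J) : OracleName J
  | select (j : Fin J) : OracleName J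

/-- The computational basis of the register that an oracle acts on: the qubits; an index and a
bit; an index, a bit, the qubits and another index. -/
abbrev Register (n : ℕ) {J : ℕ} (m : Fin J → ℕ) : OracleName J → Type
  | .state => Qubits n
  | .prepare j => Fin (m j + 1) × Fin 2
  | .select j => Fin (m j + 1) × Fin 2 × Qubits n × Fin (m j + 1)

instance instFintypeRegister (n : ℕ) {J : ℕ} (m : Fin J → ℕ) :
    ∀ o : OracleName J, Fintype (Register n m o)
  | .state => inferInstanceAs (Fintype (Qubits n))
  | .prepare j => inferInstanceAs (Fintype (Fin (m j + 1) × Fin 2))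
  | .select j => inferInstanceAs (Fintype (Fin (m j + 1) × Fin 2 × Qubits n × Fin (m j + 1)))

instance instDecidableEqRegister (n : ℕ) {J : ℕ} (m : Fin J → ℕ) :
    ∀ o : OracleName J, DecidableEq (Register n m o)
  | .state => inferInstanceAs (DecidableEq (Qubits n))
  | .prepare j => inferInstanceAs (DecidableEq (Fin (m j + 1) × Fin 2))
  | .select j =>
      inferInstanceAs (DecidableEq (Fin (m j + 1) × Fin 2 × Qubits n × Fin (m j + 1)))

/-- `∑ k ∈ s, √|b k|`. -/
def sqrtSum {N : ℕ} (b : Fin N → ℝ) (s : Finset (Fin N)) : ℝ :=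
  ∑ k ∈ s, Real.sqrt |b k|

/-- `‖β‖_{1,1/2} = ∑ j, (∑ k, √|β j k|) ^ 2`. -/
def normOneHalf {J : ℕ} {m : Fin J → ℕ} (β : (j : Fin J) → Fin (m j) → ℝ) : ℝ :=
  ∑ j, sqrtSum (β j) Finset.univ ^ 2

/-- The expectation value `⟨ψ| M |ψ⟩` (real for the Hermitian `M` used here). -/
def expVal {n : ℕ} (ψ : Qubits n → ℂ) (M : Matrix (Qubits n) (Qubits n) ℂ) : ℝ :=
  (star ψ ⬝ᵥ (M *ᵥ ψ)).re

/-- The product state `|k⟩|y⟩ v |l⟩` of the register of a `SELECT` oracle. -/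
def selectKet {n N : ℕ} (k : Fin (N + 1)) (y : Fin 2) (v : Qubits n → ℂ) (l : Fin (N + 1)) :
    Fin (N + 1) × Fin 2 × Qubits n × Fin (N + 1) → ℂ :=
  fun p => if p.1 = k ∧ p.2.1 = y ∧ p.2.2.2 = l then v p.2.2.1 else 0

/-- The unitaries `O` are oracles for the state `ψ`, the coefficients `β` and the projectors `Pr`,
where in the group `j` the terms in `T j` are loaded.

* State preparation maps `|0…0⟩` to `ψ`.
* `PREPARE` maps `|0⟩|0⟩` to `∑ k ∈ T j, ∑ y, |β j k|^{1/4} / (√2 √(∑ k ∈ T j, √|β j k|)) |k⟩|y⟩`;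
  there is no such state, and no condition, if all these coefficients vanish.
* `SELECT` acts for `k ∈ T j` as
  `|k⟩|y⟩ v |l⟩ ↦ |k⟩ Z|y⟩ (R j k)^y v (|0⟩⟨k| + |k⟩⟨0|)|l⟩` with `R j k = 1 - 2 Pr j k`, on the
  states with `l = 0` or `l = k`, where this is isometric.

On the remaining states the unitaries are arbitrary. -/
structure IsAccess {n J : ℕ} {m : Fin J → ℕ} (β : (j : Fin J) → Fin (m j) → ℝ)
    (T : (j : Fin J) → Finset (Fin (m j)))
    (Pr : (j : Fin J) → Fin (m j) → Matrix (Qubits n) (Qubits n) ℂ) (ψ : Qubits n → ℂ)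
    (O : ∀ o : OracleName J, Matrix.unitaryGroup (Register n m o) ℂ) : Prop where
  state : (O .state : Matrix (Qubits n) (Qubits n) ℂ) *ᵥ Pi.single 0 1 = ψ
  prepare : ∀ j, sqrtSum (β j) (T j) ≠ 0 →
    (O (.prepare j) : Matrix (Fin (m j + 1) × Fin 2) (Fin (m j + 1) × Fin 2) ℂ) *ᵥ
        Pi.single (0, 0) 1 =
      ∑ k ∈ T j, ∑ y : Fin 2,
        ((|β j k| ^ (1 / 4 : ℝ) / (Real.sqrt 2 * Real.sqrt (sqrtSum (β j) (T j))) : ℝ) : ℂ) •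
          (Pi.single (k.succ, y) 1 : Fin (m j + 1) × Fin 2 → ℂ)
  select_zero : ∀ j, ∀ k ∈ T j, ∀ (y : Fin 2) (v : Qubits n → ℂ),
    (O (.select j) : Matrix (Fin (m j + 1) × Fin 2 × Qubits n × Fin (m j + 1))
        (Fin (m j + 1) × Fin 2 × Qubits n × Fin (m j + 1)) ℂ) *ᵥ selectKet k.succ y v 0 =
      (-1 : ℂ) ^ (y : ℕ) • selectKet k.succ y ((1 - 2 • Pr j k) ^ (y : ℕ) *ᵥ v) k.succ
  select_index : ∀ j, ∀ k ∈ T j, ∀ (y : Fin 2) (v : Qubits n → ℂ),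
    (O (.select j) : Matrix (Fin (m j + 1) × Fin 2 × Qubits n × Fin (m j + 1))
        (Fin (m j + 1) × Fin 2 × Qubits n × Fin (m j + 1)) ℂ) *ᵥ selectKet k.succ y v k.succ =
      (-1 : ℂ) ^ (y : ℕ) • selectKet k.succ y ((1 - 2 • Pr j k) ^ (y : ℕ) *ᵥ v) 0

/-! ### Quantities in the statement -/

/-- The upper bound `P₀ = sin² (π / (2 (2 μ + 1)))`. -/
def P0 (μ : ℕ) : ℝ := Real.sin (Real.pi / (2 * (2 * (μ : ℝ) + 1))) ^ 2

/-- The required precision of the prior estimates in the group `j`,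
`ε / (2 ∑ i ∈ I j, |β j i|) * (∑ k, √|β j k|) ^ 2 / ‖β‖_{1,1/2}`. -/
def priorPrecision {J : ℕ} {m : Fin J → ℕ} (β : (j : Fin J) → Fin (m j) → ℝ)
    (I : (j : Fin J) → Finset (Fin (m j))) (ε : ℝ) (j : Fin J) : ℝ :=
  ε / (2 * ∑ i ∈ I j, |β j i|) * (sqrtSum (β j) Finset.univ ^ 2 / normOneHalf β)

/-- The normalized expectation of the remaining projectors of the group `j`,
`(∑ k ∉ I j, |β j k| ⟨ψ|Pr j k|ψ⟩) / (∑ k ∉ I j, √|β j k|) ^ 2`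
(it is `0` if there is no remaining projector with a nonzero coefficient). -/
def remainingProb {n J : ℕ} {m : Fin J → ℕ} (β : (j : Fin J) → Fin (m j) → ℝ)
    (I : (j : Fin J) → Finset (Fin (m j)))
    (Pr : (j : Fin J) → Fin (m j) → Matrix (Qubits n) (Qubits n) ℂ) (ψ : Qubits n → ℂ)
    (j : Fin J) : ℝ :=
  (∑ k ∈ (I j)ᶜ, |β j k| * expVal ψ (Pr j k)) / sqrtSum (β j) (I j)ᶜ ^ 2

end AAE

end

/-! Split the expectation value by groups. Write S(s) = ∑_{k∈s} √|β_jk|, N_j = S([n_j])² and ‖β‖ =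
∑_j N_j. Inside I_j the prior estimates replace the expectation values, at a cost of at most ε/2
times the share N_j/‖β‖. Since the coefficients of a group have one sign, the rest of the group is,
up to that sign, X_j = ∑_{k∉I_j} |β_jk|⟨Π_jk⟩, which must be found within ε/2 times the same share.

State preparation, PREPARE, SELECT and the inverse of PREPARE leave √|β_jk|/S(T_j) · Π_jk ψ next to
the recorded index k (`run_groupCircuit`). Hence an index outside I_j is recorded with probability p
= X_j/S(T_j)² (`goodProb_groupCircuit`), and p ≤ P₀(j) because T_j contains the complement of I_j.
Small probabilities are cheap to estimate: O(K) uses of a circuit give mean square error O(p/K² +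
1/K⁴) (`exists_amplitudeEstimation`). With η = ε/(2‖β‖), choosing K of order √P₀/η gives precision
of order η with constant success probability (`exists_groupEstimator`). Voting among O(log(J/δ'))
runs and a union bound over j finish the construction. The factor max P₀/|δ_j| in the query bound is
at least 1, as |δ_j| ≤ P₀(j), so it is slack.

Amplitude estimation is done without a Fourier transform. The Grover iterates v_x = G^x|h₀⟩ satisfy
v_{x+1} + v_{x-1} = 2(1-2p)v_x. So for a slowly varying window w, the state Φ = ∑ w_x |x⟩v_x is
nearly an eigenvector, with eigenvalue 1-2p, of the path operator on the control register. Measuring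
that operator has mean square deviation ‖(path - (1-2p))Φ‖², which is controlled by the squared
second differences of w and by p times the products of neighbouring first differences. -/

noncomputable section

namespace AAE

/-! ### Linear algebra of circuits: lifting, inverses, parallel composition. -/

section Circuits

variable {ι : Type} {D : ι → Type}

/-- The squared Euclidean norm of a vector. -/
def nsq {α : Type} [Fintype α] (v : α → ℂ) : ℝ := ∑ a, ‖v a‖ ^ 2

theorem nsq_eq_dotProduct {α : Type} [Fintype α] (v : α → ℂ) : (nsq v : ℂ) = star v ⬝ᵥ v := by
  simp only [nsq, dotProduct, Pi.star_apply, Complex.ofReal_sum]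
  refine Finset.sum_congr rfl fun a _ => ?_
  rw [RCLike.star_def, Complex.conj_mul']
  push_cast
  rfl

theorem nsq_nonneg {α : Type} [Fintype α] (v : α → ℂ) : 0 ≤ nsq v :=
  Finset.sum_nonneg fun _ _ => by positivity

theorem nsq_single {α : Type} [Fintype α] [DecidableEq α] (a : α) :
    nsq (Pi.single a 1 : α → ℂ) = 1 := by
  have h : (nsq (Pi.single a 1 : α → ℂ) : ℂ) = 1 := by
    rw [nsq_eq_dotProduct]; simp
  exact_mod_cast h

theorem nsq_mulVec {α : Type} [Fintype α] [DecidableEq α] {A : Matrix α α ℂ} (hA : Aᴴ * A = 1)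
    (v : α → ℂ) : nsq (A *ᵥ v) = nsq v := by
  have h : (nsq (A *ᵥ v) : ℂ) = nsq v := by
    rw [nsq_eq_dotProduct, nsq_eq_dotProduct, Matrix.star_mulVec, ← Matrix.dotProduct_mulVec,
      Matrix.mulVec_mulVec, hA, Matrix.one_mulVec]
  exact_mod_cast h

/-- A matrix acting on the first factor of a tensor product acts on the slices of a vector. -/
theorem kronecker_one_submatrix_mulVec {Ω Ω' R : Type} [Fintype Ω] [Fintype Ω'] [DecidableEq R]
    (A : Matrix Ω Ω ℂ) (e : Ω' ≃ Ω × R) (Φ : Ω' → ℂ) (ω : Ω') :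
    ((A ⊗ₖ (1 : Matrix R R ℂ)).submatrix e e *ᵥ Φ) ω =
      (A *ᵥ fun a => Φ (e.symm (a, (e ω).2))) (e ω).1 := by
  -- The spectator factor `R` of a query gate is not assumed finite; fixing the first coordinate
  -- embeds it in the finite `Ω'`.
  have : Finite R := Finite.of_injective (fun r => e.symm ((e ω).1, r)) fun r s h => by
    simpa using h
  have : Fintype R := Fintype.ofFinite R
  simp only [Matrix.mulVec, dotProduct, Matrix.submatrix_apply]
  rw [← Equiv.sum_comp e.symm, Fintype.sum_prod_type]
  refine Finset.sum_congr rfl fun a _ => ?_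
  simp [Matrix.kroneckerMap_apply, Matrix.one_apply]

theorem conjTranspose_mul_kronecker_one_submatrix {Ω Ω' R : Type} [Fintype Ω] [Fintype Ω']
    [DecidableEq Ω] [DecidableEq Ω'] [DecidableEq R] {A : Matrix Ω Ω ℂ} (hA : Aᴴ * A = 1)
    (e : Ω' ≃ Ω × R) :
    ((A ⊗ₖ (1 : Matrix R R ℂ)).submatrix e e)ᴴ * (A ⊗ₖ (1 : Matrix R R ℂ)).submatrix e e = 1 := by
  rcases isEmpty_or_nonempty Ω' with h | ⟨⟨ω⟩⟩
  · exact Subsingleton.elim _ _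
  have : Finite R := Finite.of_injective (fun r => e.symm ((e ω).1, r)) fun r s h => by
    simpa using h
  have : Fintype R := Fintype.ofFinite R
  rw [Matrix.conjTranspose_submatrix, Matrix.submatrix_mul_equiv, Matrix.conjTranspose_kronecker,
    ← Matrix.mul_kronecker_mul, hA, Matrix.conjTranspose_one, one_mul, Matrix.one_kronecker_one,
    Matrix.submatrix_one_equiv]

theorem unitary_conjTranspose_mul {α : Type} [Fintype α] [DecidableEq α]
    (U : Matrix.unitaryGroup α ℂ) : (U : Matrix α α ℂ)ᴴ * (U : Matrix α α ℂ) = 1 :=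
  Matrix.mem_unitaryGroup_iff'.1 U.2

theorem unitary_mul_conjTranspose {α : Type} [Fintype α] [DecidableEq α]
    (U : Matrix.unitaryGroup α ℂ) : (U : Matrix α α ℂ) * (U : Matrix α α ℂ)ᴴ = 1 :=
  Matrix.mem_unitaryGroup_iff.1 U.2

/-- A gate on the first factor of a splitting, as a gate on the whole space. -/
def Gate.lift {Ω Ω' R : Type} [Fintype Ω] [DecidableEq Ω] [Fintype Ω'] [DecidableEq Ω']
    [DecidableEq R] (e : Ω' ≃ Ω × R) : Gate D Ω → Gate D Ω'
  | .free U => .free ⟨((U : Matrix Ω Ω ℂ) ⊗ₖ (1 : Matrix R R ℂ)).submatrix e e,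
      Matrix.mem_unitaryGroup_iff'.2
        (conjTranspose_mul_kronecker_one_submatrix (unitary_conjTranspose_mul U) e)⟩
  | @Gate.query _ _ _ _ _ o inverse S _ e' =>
      .query o inverse (S × R) ((e.trans (e'.prodCongr (Equiv.refl R))).trans
        (Equiv.prodAssoc (D o) S R))

@[simp]
theorem Gate.isQuery_lift {Ω Ω' R : Type} [Fintype Ω] [DecidableEq Ω] [Fintype Ω']
    [DecidableEq Ω'] [DecidableEq R] (e : Ω' ≃ Ω × R) (g : Gate D Ω) :
    (g.lift e).isQuery = g.isQuery := by
  cases g <;> rfl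

/-- The inverse gate. -/
def Gate.inv {Ω : Type} [Fintype Ω] [DecidableEq Ω] : Gate D Ω → Gate D Ω
  | .free U => .free U⁻¹
  | @Gate.query _ _ _ _ _ o inverse R _ e => .query o (!inverse) R e

@[simp]
theorem Gate.isQuery_inv {Ω : Type} [Fintype Ω] [DecidableEq Ω] (g : Gate D Ω) :
    g.inv.isQuery = g.isQuery := by
  cases g <;> rfl

/-- The independent parallel execution of finitely many algorithms. -/
def parallel {κ : Type} [Fintype κ] [DecidableEq κ] (𝒜 : κ → QueryAlgorithm D)
    (output : (∀ i, (𝒜 i).Ω) → ℝ) : QueryAlgorithm D where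
  Ω := ∀ i, (𝒜 i).Ω
  init := fun i => (𝒜 i).init
  gates := (Finset.univ : Finset κ).toList.flatMap fun i =>
    (𝒜 i).gates.map (Gate.lift (Equiv.piSplitAt i fun i => (𝒜 i).Ω))
  output := output

theorem numQueries_parallel {κ : Type} [Fintype κ] [DecidableEq κ] (𝒜 : κ → QueryAlgorithm D)
    (output : (∀ i, (𝒜 i).Ω) → ℝ) :
    (parallel 𝒜 output).numQueries = ∑ i, (𝒜 i).numQueries := by
  simp only [QueryAlgorithm.numQueries]
  refine (List.countP_flatMap ..).trans ?_
  rw [← Finset.sum_map_toList]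
  congr 1
  refine List.map_congr_left fun i _ => ?_
  refine (List.countP_map ..).trans ?_
  congr 1
  ext g
  exact Gate.isQuery_lift _ g

variable [∀ o, Fintype (D o)] [∀ o, DecidableEq (D o)]

theorem Gate.toMatrix_lift {Ω Ω' R : Type} [Fintype Ω] [DecidableEq Ω] [Fintype Ω']
    [DecidableEq Ω'] [DecidableEq R] (O : ∀ o, Matrix.unitaryGroup (D o) ℂ) (e : Ω' ≃ Ω × R)
    (g : Gate D Ω) :
    (g.lift e).toMatrix O = (g.toMatrix O ⊗ₖ (1 : Matrix R R ℂ)).submatrix e e := by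
  cases g with
  | free U => rfl
  | query o b S e' =>
    ext x y
    simp only [Gate.lift, Gate.toMatrix, Matrix.submatrix_apply, Matrix.kroneckerMap_apply,
      Matrix.one_apply, Prod.ext_iff, ite_and, Equiv.trans_apply, Equiv.prodCongr_apply,
      Prod.map_fst, Prod.map_snd, Equiv.prodAssoc_apply, Equiv.refl_apply, mul_ite, mul_one,
      mul_zero]
    split_ifs <;> rfl

theorem Gate.toMatrix_inv {Ω : Type} [Fintype Ω] [DecidableEq Ω]
    (O : ∀ o, Matrix.unitaryGroup (D o) ℂ) (g : Gate D Ω) :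
    g.inv.toMatrix O = (g.toMatrix O)ᴴ := by
  cases g with
  | free U => rfl
  | query o b S e' =>
    ext x y
    cases b <;> simp [Gate.inv, Gate.toMatrix, Matrix.one_apply, eq_comm, apply_ite (starRingEnd ℂ)]

theorem Gate.conjTranspose_mul_toMatrix {Ω : Type} [Fintype Ω] [DecidableEq Ω]
    (O : ∀ o, Matrix.unitaryGroup (D o) ℂ) (g : Gate D Ω) :
    (g.toMatrix O)ᴴ * g.toMatrix O = 1 := by
  cases g with
  | free U => exact unitary_conjTranspose_mul U
  | query o b S e' =>
    refine conjTranspose_mul_kronecker_one_submatrix ?_ e'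
    cases b
    · exact unitary_conjTranspose_mul _
    · simpa using unitary_mul_conjTranspose (O o)

/-- The action of a list of gates, in the order of application. -/
def run {Ω : Type} [Fintype Ω] [DecidableEq Ω] (O : ∀ o, Matrix.unitaryGroup (D o) ℂ)
    (L : List (Gate D Ω)) (v : Ω → ℂ) : Ω → ℂ :=
  L.foldl (fun v g => g.toMatrix O *ᵥ v) v

/-! ### Circuits as isometries. -/

section Run

variable {Ω : Type} [Fintype Ω] [DecidableEq Ω] (O : ∀ o, Matrix.unitaryGroup (D o) ℂ)

@[simp]
theorem run_nil (v : Ω → ℂ) : run O ([] : List (Gate D Ω)) v = v := rfl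

@[simp]
theorem run_cons (g : Gate D Ω) (L : List (Gate D Ω)) (v : Ω → ℂ) :
    run O (g :: L) v = run O L (g.toMatrix O *ᵥ v) := rfl

@[simp]
theorem run_append (L L' : List (Gate D Ω)) (v : Ω → ℂ) :
    run O (L ++ L') v = run O L' (run O L v) := List.foldl_append

theorem nsq_run (L : List (Gate D Ω)) (v : Ω → ℂ) : nsq (run O L v) = nsq v := by
  induction L generalizing v with
  | nil => rfl
  | cons g L ih => rw [run_cons, ih, nsq_mulVec (g.conjTranspose_mul_toMatrix O)]

/-- The operator performed by a list of gates. -/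
def circuitMatrix : List (Gate D Ω) → Matrix Ω Ω ℂ
  | [] => 1
  | g :: L => circuitMatrix L * g.toMatrix O

theorem run_eq_mulVec (L : List (Gate D Ω)) (v : Ω → ℂ) :
    run O L v = circuitMatrix O L *ᵥ v := by
  induction L generalizing v with
  | nil => simp [circuitMatrix]
  | cons g L ih => rw [run_cons, ih, circuitMatrix, Matrix.mulVec_mulVec]

theorem conjTranspose_mul_circuitMatrix (L : List (Gate D Ω)) :
    (circuitMatrix O L)ᴴ * circuitMatrix O L = 1 := by
  induction L with
  | nil => simp [circuitMatrix]
  | cons g L ih =>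
    rw [circuitMatrix, Matrix.conjTranspose_mul, Matrix.mul_assoc, ← Matrix.mul_assoc _ _
      (g.toMatrix O), ih, Matrix.one_mul, g.conjTranspose_mul_toMatrix]

/-- The inverse circuit. -/
def circuitInv (L : List (Gate D Ω)) : List (Gate D Ω) := (L.map Gate.inv).reverse

theorem run_circuitInv (L : List (Gate D Ω)) (v : Ω → ℂ) :
    run O (circuitInv L) v = (circuitMatrix O L)ᴴ *ᵥ v := by
  induction L generalizing v with
  | nil => simp [circuitMatrix, circuitInv]
  | cons g L ih =>
    have : circuitInv (g :: L) = circuitInv L ++ [g.inv] := by simp [circuitInv]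
    rw [this, run_append, ih, run_cons, run_nil, Gate.toMatrix_inv, Matrix.mulVec_mulVec,
      circuitMatrix, Matrix.conjTranspose_mul]

/-- A circuit on the first factor of a splitting acts on the slices of a vector. -/
theorem run_map_lift {Ω' R : Type} [Fintype Ω'] [DecidableEq Ω'] [DecidableEq R]
    (e : Ω' ≃ Ω × R) (L : List (Gate D Ω)) (Φ : Ω' → ℂ) (ω : Ω') :
    run O (L.map (Gate.lift e)) Φ ω = run O L (fun a => Φ (e.symm (a, (e ω).2))) (e ω).1 := by
  induction L generalizing Φ with
  | nil => simp
  | cons g L ih =>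
    rw [List.map_cons, run_cons, run_cons, ih]
    congr 1
    ext a
    rw [Gate.toMatrix_lift, kronecker_one_submatrix_mulVec]
    simp

end Run

theorem finalState_eq_run (𝒜 : QueryAlgorithm D) (O : ∀ o, Matrix.unitaryGroup (D o) ℂ) :
    𝒜.finalState O = run O 𝒜.gates (Pi.single 𝒜.init 1) := rfl

theorem nsq_finalState (𝒜 : QueryAlgorithm D) (O : ∀ o, Matrix.unitaryGroup (D o) ℂ) :
    nsq (𝒜.finalState O) = 1 := by
  rw [finalState_eq_run, nsq_run, nsq_single]

/-! ### Running algorithms in parallel -/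

/-- The initial basis state is a product, and each lifted circuit changes only its own factor, so
the state stays a product throughout. -/
theorem finalState_parallel {κ : Type} [Fintype κ] [DecidableEq κ] (𝒜 : κ → QueryAlgorithm D)
    (output : (∀ i, (𝒜 i).Ω) → ℝ) (O : ∀ o, Matrix.unitaryGroup (D o) ℂ) :
    (parallel 𝒜 output).finalState O = fun ω => ∏ i, (𝒜 i).finalState O (ω i) := by
  have step : ∀ (i : κ) (φ : ∀ i, (𝒜 i).Ω → ℂ),
      run O ((𝒜 i).gates.map (Gate.lift (Equiv.piSplitAt i fun i => (𝒜 i).Ω)))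
        (fun ω => ∏ k, φ k (ω k)) =
      fun ω => ∏ k, Function.update φ i (run O (𝒜 i).gates (φ i)) k (ω k) := by
    intro i φ
    ext ω
    rw [run_map_lift, ← Finset.mul_prod_erase _ _ (Finset.mem_univ i), Function.update_self]
    have h1 : ∀ k ∈ Finset.univ.erase i,
        Function.update φ i (run O (𝒜 i).gates (φ i)) k (ω k) = φ k (ω k) := by
      intro k hk
      rw [Function.update_of_ne (Finset.ne_of_mem_erase hk)]
    rw [Finset.prod_congr rfl h1]
    have h2 : (fun a => ∏ k, φ k ((Equiv.piSplitAt i fun i => (𝒜 i).Ω).symm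
        (a, ((Equiv.piSplitAt i fun i => (𝒜 i).Ω) ω).2) k)) =
        (∏ k ∈ Finset.univ.erase i, φ k (ω k)) • φ i := by
      ext a
      rw [← Finset.mul_prod_erase _ _ (Finset.mem_univ i), Pi.smul_apply, smul_eq_mul, mul_comm]
      congr 1
      · refine Finset.prod_congr rfl fun k hk => ?_
        simp [Equiv.piSplitAt, Finset.ne_of_mem_erase hk]
      · simp [Equiv.piSplitAt]
    rw [h2, run_eq_mulVec, run_eq_mulVec, Matrix.mulVec_smul, Pi.smul_apply, smul_eq_mul, mul_comm]
    rfl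
  have main : ∀ (l : List κ), l.Nodup → ∀ φ : ∀ i, (𝒜 i).Ω → ℂ,
      run O (l.flatMap fun i => (𝒜 i).gates.map (Gate.lift (Equiv.piSplitAt i fun i => (𝒜 i).Ω)))
        (fun ω => ∏ k, φ k (ω k)) =
      fun ω => ∏ k, (if k ∈ l then run O (𝒜 k).gates (φ k) else φ k) (ω k) := by
    intro l
    induction l with
    | nil => intro _ φ; simp
    | cons i l ih =>
      intro hl φ
      rw [List.flatMap_cons, run_append, step, ih hl.of_cons]
      ext ω
      refine Finset.prod_congr rfl fun k _ => ?_
      have hi := (List.nodup_cons.1 hl).1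
      by_cases hk : k = i
      · subst hk; simp [hi]
      · simp [hk]
  have h0 : (Pi.single (fun i => (𝒜 i).init) 1 : (∀ i, (𝒜 i).Ω) → ℂ) =
      fun ω => ∏ k, (Pi.single (𝒜 k).init 1 : (𝒜 k).Ω → ℂ) (ω k) := by
    ext ω
    simp only [Pi.single_apply]
    rw [Fintype.prod_ite_zero, Finset.prod_const_one]
    simp only [funext_iff]
  have := main (Finset.univ : Finset κ).toList (Finset.nodup_toList _)
    fun k => Pi.single (𝒜 k).init 1
  rw [← h0] at this
  refine this.trans ?_
  simp only [Finset.mem_toList, Finset.mem_univ, if_true]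
  rfl

/-- Measuring a parallel execution gives independent outcomes. -/
theorem sum_finalState_parallel {κ : Type} [Fintype κ] [DecidableEq κ]
    (𝒜 : κ → QueryAlgorithm D) (output : (∀ i, (𝒜 i).Ω) → ℝ)
    (O : ∀ o, Matrix.unitaryGroup (D o) ℂ) (f : ∀ i, (𝒜 i).Ω → ℝ) :
    ∑ ω : ∀ i, (𝒜 i).Ω, ‖(parallel 𝒜 output).finalState O ω‖ ^ 2 * ∏ i, f i (ω i) =
      ∏ i, ∑ ω, ‖(𝒜 i).finalState O ω‖ ^ 2 * f i ω := by
  rw [Finset.prod_univ_sum, Fintype.piFinset_univ]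
  refine Finset.sum_congr rfl fun ω _ => ?_
  rw [finalState_parallel, norm_prod, ← Finset.prod_pow, ← Finset.prod_mul_distrib]

end Circuits

/-! ### Amplitude estimation -/

/-- A unitary that maps a basis state to a given real unit vector. -/
theorem exists_unitary_mulVec_single {α : Type} [Fintype α] [DecidableEq α] (a : α) (f : α → ℝ)
    (hf : ∑ x, f x ^ 2 = 1) :
    ∃ U : Matrix.unitaryGroup α ℂ,
      (U : Matrix α α ℂ) *ᵥ Pi.single a 1 = fun x => (f x : ℂ) := by
  -- Householder reflection: the reflection along the difference of the two unit vectors exchanges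
  -- them. It degenerates exactly when they coincide, that is, when `f a = 1`.
  set w : α → ℂ := fun x => (Pi.single a 1 : α → ℂ) x - (f x : ℂ) with hw
  have hstar : star w = w := by
    ext x
    by_cases h : x = a <;> simp [hw, h]
  have hdot : w ⬝ᵥ w = 2 - 2 * (f a : ℂ) := by
    have h1 : ∑ x, (f x : ℂ) ^ 2 = 1 := by exact_mod_cast hf
    have h2 : ∀ x, w x * w x = (Pi.single a 1 : α → ℂ) x * (1 - 2 * (f x : ℂ)) + (f x : ℂ) ^ 2 := by
      intro x
      by_cases h : x = a
      · subst h; simp [hw]; ring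
      · simp [hw, h]; ring
    simp only [dotProduct, h2, Finset.sum_add_distrib, h1]
    rw [Finset.sum_eq_single a (fun b _ hb => by simp [hb]) (by simp)]
    simp; ring
  by_cases hs : f a = 1
  · refine ⟨1, ?_⟩
    have h0 : nsq w = 0 := by
      have : (nsq w : ℂ) = 0 := by rw [nsq_eq_dotProduct, hstar, hdot, hs]; norm_num
      exact_mod_cast this
    ext x
    have := (Finset.sum_eq_zero_iff_of_nonneg (fun b _ => by positivity)).1 h0 x (Finset.mem_univ x)
    have hx : w x = 0 := by simpa using this
    rw [OneMemClass.coe_one, Matrix.one_mulVec]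
    exact sub_eq_zero.1 hx
  · have hs' : (1 - (f a : ℂ)) ≠ 0 := by
      intro h
      apply hs
      have : (f a : ℂ) = 1 := (sub_eq_zero.1 h).symm
      exact_mod_cast this
    set q : ℂ := (1 - (f a : ℂ))⁻¹ with hq
    have hqs : star q = q := by simp [hq]
    have hH : (1 - q • Matrix.vecMulVec w w)ᴴ = 1 - q • Matrix.vecMulVec w w := by
      rw [Matrix.conjTranspose_sub, Matrix.conjTranspose_smul, Matrix.conjTranspose_one,
        Matrix.conjTranspose_vecMulVec, hstar, hqs]
    refine ⟨⟨1 - q • Matrix.vecMulVec w w, Matrix.mem_unitaryGroup_iff'.2 ?_⟩, ?_⟩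
    · have hW : (q • Matrix.vecMulVec w w) * (q • Matrix.vecMulVec w w) =
          (2 : ℂ) • (q • Matrix.vecMulVec w w) := by
        rw [Matrix.smul_mul, Matrix.mul_smul, Matrix.vecMulVec_mul_vecMulVec, hdot,
          Matrix.vecMulVec_smul, smul_smul, smul_smul, smul_smul]
        congr 1
        rw [hq]; field_simp
      rw [Matrix.star_eq_conjTranspose, hH, sub_mul, mul_sub, mul_sub, hW, two_smul, one_mul,
        one_mul, mul_one]
      abel
    · have hwa : w a = 1 - (f a : ℂ) := by simp [hw]
      ext x
      change ((1 - q • Matrix.vecMulVec w w) *ᵥ Pi.single a 1) x = _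
      rw [Matrix.sub_mulVec, Matrix.one_mulVec, Matrix.smul_mulVec, Pi.sub_apply,
        Pi.smul_apply, Matrix.mulVec_single_one, Matrix.col_apply, Matrix.vecMulVec_apply, hwa,
        smul_eq_mul, mul_comm (w x), ← mul_assoc, hq, inv_mul_cancel₀ hs', one_mul]
      simp [hw]

/-- The variance of the outcome of measuring an observable in its eigenbasis. -/
theorem sum_eigenvalues_sub_sq {α : Type} [Fintype α] [DecidableEq α] {A : Matrix α α ℂ}
    (hA : A.IsHermitian) (c : ℝ) (v : α → ℂ) :
    ∑ y, ‖((hA.eigenvectorUnitary : Matrix α α ℂ)ᴴ *ᵥ v) y‖ ^ 2 * (hA.eigenvalues y - c) ^ 2 =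
      nsq (A *ᵥ v - (c : ℂ) • v) := by
  set E : Matrix α α ℂ := (hA.eigenvectorUnitary : Matrix α α ℂ) with hE
  have h1 : Eᴴᴴ * Eᴴ = 1 := by
    rw [Matrix.conjTranspose_conjTranspose]; exact unitary_mul_conjTranspose _
  have h2 : Eᴴ * A = Matrix.diagonal (fun y => (hA.eigenvalues y : ℂ)) * Eᴴ := by
    have hs := hA.spectral_theorem
    rw [Unitary.conjStarAlgAut_apply] at hs
    conv_lhs => rw [hs]
    rw [Matrix.mul_assoc, ← Matrix.mul_assoc, unitary_conjTranspose_mul, Matrix.one_mul]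
    rfl
  rw [← nsq_mulVec h1, Matrix.mulVec_sub, Matrix.mulVec_mulVec, h2, ← Matrix.mulVec_mulVec,
    Matrix.mulVec_smul]
  refine Finset.sum_congr rfl fun y _ => ?_
  rw [Pi.sub_apply, Matrix.mulVec_diagonal, Pi.smul_apply, smul_eq_mul, ← sub_mul, norm_mul,
    mul_pow, mul_comm]
  congr 1
  rw [← Complex.ofReal_sub, Complex.norm_real, Real.norm_eq_abs, sq_abs]

/-- The weighted adjacency matrix of a path. -/
def pathMatrix (L : ℕ) : Matrix (Fin (L + 1)) (Fin (L + 1)) ℂ :=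
  fun x y => if (x : ℕ) + 1 = y ∨ (y : ℕ) + 1 = x then 1 / 2 else 0

theorem pathMatrix_isHermitian (L : ℕ) : (pathMatrix L).IsHermitian := by
  ext x y
  simp only [Matrix.conjTranspose_apply, pathMatrix, or_comm]
  split_ifs <;> simp

theorem pathMatrix_mulVec (L : ℕ) (w : ℕ → ℂ) (x : Fin (L + 1)) :
    (pathMatrix L *ᵥ fun y => w y) x =
      1 / 2 * (if (x : ℕ) < L then w (x + 1) else 0) +
        1 / 2 * (if 0 < (x : ℕ) then w (x - 1) else 0) := by
  have h : ∀ y : ℕ, (if (x : ℕ) + 1 = y ∨ y + 1 = (x : ℕ) then (1 / 2 : ℂ) else 0) * w y =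
      (if (x : ℕ) + 1 = y then 1 / 2 * w y else 0) +
        (if y + 1 = (x : ℕ) then 1 / 2 * w y else 0) := by
    intro y
    by_cases h1 : (x : ℕ) + 1 = y
    · rw [if_pos (Or.inl h1), if_pos h1, if_neg (by omega), add_zero]
    · by_cases h2 : y + 1 = (x : ℕ)
      · rw [if_pos (Or.inr h2), if_neg h1, if_pos h2, zero_add]
      · rw [if_neg (by tauto), if_neg h1, if_neg h2, zero_mul, zero_add]
  simp only [Matrix.mulVec, dotProduct, pathMatrix]
  rw [Fin.sum_univ_eq_sum_range
    (fun y => (if (x : ℕ) + 1 = y ∨ y + 1 = (x : ℕ) then (1 / 2 : ℂ) else 0) * w y)]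
  simp only [h, Finset.sum_add_distrib]
  congr 1
  · rw [Finset.sum_ite_eq]
    simp only [Finset.mem_range, mul_ite, mul_zero, add_lt_add_iff_right]
  · rcases Nat.eq_zero_or_pos (x : ℕ) with h0 | h0
    · simp [h0]
    · have h3 : ∀ y : ℕ, y + 1 = (x : ℕ) ↔ (x : ℕ) - 1 = y := by omega
      simp only [h3]
      rw [Finset.sum_ite_eq, if_pos (by rw [Finset.mem_range]; omega), if_pos h0]

/-- The diagonal sign operator that is `-1` where `s` holds. -/
def signMatrix {H : Type} [DecidableEq H] (s : H → Prop) [DecidablePred s] : Matrix H H ℂ :=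
  Matrix.diagonal fun h => if s h then -1 else 1

theorem signMatrix_conjTranspose {H : Type} [DecidableEq H] (s : H → Prop) [DecidablePred s] :
    (signMatrix s)ᴴ = signMatrix s := by
  rw [signMatrix, Matrix.diagonal_conjTranspose]
  congr 1
  ext h
  rw [Pi.star_apply]
  split_ifs <;> simp

theorem nsq_real_combination {H : Type} [Fintype H] {e s : H → ℂ} {c : ℝ} (he : nsq e = 1) (hs : nsq s = 1)
    (hes : star e ⬝ᵥ s = (c : ℂ)) (a b : ℝ) :
    nsq ((a : ℂ) • e + (b : ℂ) • s) = a ^ 2 + b ^ 2 + 2 * a * b * c := by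
  have hse : star s ⬝ᵥ e = (c : ℂ) := by
    rw [← star_inj, ← Matrix.star_dotProduct_star, star_star, hes]
    simp
  have h : (nsq ((a : ℂ) • e + (b : ℂ) • s) : ℂ) = a ^ 2 + b ^ 2 + 2 * a * b * c := by
    rw [nsq_eq_dotProduct]
    simp only [star_add, star_smul, add_dotProduct, dotProduct_add, smul_dotProduct,
      dotProduct_smul, ← nsq_eq_dotProduct, he, hs, hes, hse, smul_eq_mul]
    simp
    ring
  exact_mod_cast h

/-! ### The three-term recurrence of Grover iterates. -/

section Reflections

variable {H : Type} [Fintype H] [DecidableEq H]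

theorem signMatrix_mul_self (s : H → Prop) [DecidablePred s] :
    signMatrix s * signMatrix s = 1 := by
  rw [signMatrix, Matrix.diagonal_mul_diagonal, ← Matrix.diagonal_one]
  congr 1
  ext h
  split_ifs <;> simp

theorem signMatrix_mulVec_apply (s : H → Prop) [DecidablePred s] (v : H → ℂ) (h : H) :
    (signMatrix s *ᵥ v) h = if s h then -v h else v h := by
  rw [signMatrix, Matrix.mulVec_diagonal]
  split_ifs <;> simp

/-- The product of the reflection that fixes the basis state `h₀` with the operator `V`. -/
def grover (V : Matrix H H ℂ) (h₀ : H) : Matrix H H ℂ := signMatrix (· ≠ h₀) * V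

variable {V : Matrix H H ℂ} (hV : Vᴴ = V) (hVV : V * V = 1) (h₀ : H)

include hV hVV

theorem grover_mul_conjTranspose : grover V h₀ * (grover V h₀)ᴴ = 1 := by
  rw [grover, Matrix.conjTranspose_mul, signMatrix_conjTranspose, hV, Matrix.mul_assoc,
    ← Matrix.mul_assoc V, hVV, Matrix.one_mul, signMatrix_mul_self]

theorem conjTranspose_mul_grover : (grover V h₀)ᴴ * grover V h₀ = 1 :=
  mul_eq_one_comm.1 (grover_mul_conjTranspose hV hVV h₀)

theorem conjTranspose_mul_grover_pow (x : ℕ) :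
    (grover V h₀ ^ x)ᴴ * grover V h₀ ^ x = 1 := by
  rw [Matrix.conjTranspose_pow]
  exact (Commute.mul_pow (by
    rw [Commute, SemiconjBy, conjTranspose_mul_grover hV hVV, grover_mul_conjTranspose hV hVV])
    x).symm.trans (by rw [conjTranspose_mul_grover hV hVV, one_pow])

/-- With e = |h₀⟩ and s = V e one has G s = e and G e = 2c e - s, so three consecutive iterates are
the isometry G^(x+1) applied to 2c e - s, e and s. The norm is then computed in the plane of e and
s, where ⟨e, s⟩ = c. Equal weights give zero: only the variation of the window contributes. -/
theorem nsq_grover_recurrence {c : ℝ} (hc : V h₀ h₀ = c) (x : ℕ) (g₁ g₂ g : ℝ) :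
    nsq (((1 / 2 * g₁ : ℝ) : ℂ) • (grover V h₀ ^ (x + 2) *ᵥ Pi.single h₀ 1) +
        ((1 / 2 * g₂ : ℝ) : ℂ) • (grover V h₀ ^ x *ᵥ Pi.single h₀ 1) -
        ((c * g : ℝ) : ℂ) • (grover V h₀ ^ (x + 1) *ᵥ Pi.single h₀ 1)) =
      c ^ 2 * ((g₁ - g) * (g₂ - g)) + 1 / 4 * (g₁ - g₂) ^ 2 := by
  set G := grover V h₀ with hG
  set e : H → ℂ := Pi.single h₀ 1 with he
  set s : H → ℂ := V *ᵥ e with hs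
  have hGs : G *ᵥ s = e := by
    rw [hs, Matrix.mulVec_mulVec, hG, grover, Matrix.mul_assoc, hVV, Matrix.mul_one]
    ext h
    rw [signMatrix_mulVec_apply]
    by_cases hh : h = h₀ <;> simp [he, hh]
  have hs0 : s h₀ = c := by rw [hs, he, Matrix.mulVec_single_one]; exact hc
  have hGe : G *ᵥ e = ((2 * c : ℝ) : ℂ) • e - s := by
    rw [hG, grover, ← Matrix.mulVec_mulVec]
    ext h
    rw [signMatrix_mulVec_apply]
    by_cases hh : h = h₀
    · subst hh
      rw [if_neg (by simp)]
      simp only [Pi.sub_apply, Pi.smul_apply]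
      rw [← hs, hs0, he, Pi.single_eq_same]
      push_cast
      simp; ring
    · simp [he, hh, hs]
  have h2 : G ^ (x + 2) *ᵥ e = G ^ (x + 1) *ᵥ (((2 * c : ℝ) : ℂ) • e - s) := by
    rw [← hGe, Matrix.mulVec_mulVec, ← pow_succ]
  have h0 : G ^ x *ᵥ e = G ^ (x + 1) *ᵥ s := by
    rw [pow_succ, ← Matrix.mulVec_mulVec, hGs]
  rw [h2, h0, ← Matrix.mulVec_smul (G ^ (x + 1)), ← Matrix.mulVec_smul (G ^ (x + 1)),
    ← Matrix.mulVec_smul (G ^ (x + 1)), ← Matrix.mulVec_add, ← Matrix.mulVec_sub,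
    nsq_mulVec (conjTranspose_mul_grover_pow hV hVV h₀ (x + 1))]
  have hcomb : ((1 / 2 * g₁ : ℝ) : ℂ) • (((2 * c : ℝ) : ℂ) • e - s) + ((1 / 2 * g₂ : ℝ) : ℂ) • s -
      ((c * g : ℝ) : ℂ) • e =
      ((c * (g₁ - g) : ℝ) : ℂ) • e + ((1 / 2 * (g₂ - g₁) : ℝ) : ℂ) • s := by
    ext h
    simp only [Pi.add_apply, Pi.sub_apply, Pi.smul_apply, smul_eq_mul]
    push_cast
    ring
  have hVu : Vᴴ * V = 1 := by rw [hV, hVV]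
  have hes : star e ⬝ᵥ s = (c : ℂ) := by
    rw [← hs0, he]; simp
  rw [hcomb, nsq_real_combination (nsq_single h₀) ((nsq_mulVec hVu e).trans (nsq_single h₀)) hes]
  ring

end Reflections

/-! ### The window -/

/-- An unnormalized window on `{0, …, L}` that vanishes to second order at the ends. -/
def window (L : ℕ) (x : ℕ) : ℝ := ((x : ℝ) * (L - x)) ^ 2

/-- On the middle half K ≤ x ≤ 3K one has x(4K - x) ≥ 3K², and this range has more than 2K points.
-/
theorem sum_window_sq_ge {K : ℕ} :
    162 * (K : ℝ) ^ 9 ≤ ∑ x ∈ Finset.range (4 * K + 1), window (4 * K) x ^ 2 := by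
  have h1 : ∑ x ∈ Finset.Icc K (3 * K), (81 * (K : ℝ) ^ 8) ≤
      ∑ x ∈ Finset.Icc K (3 * K), window (4 * K) x ^ 2 := by
    refine Finset.sum_le_sum fun x hx => ?_
    rw [Finset.mem_Icc] at hx
    have a : (K : ℝ) ≤ x := by exact_mod_cast hx.1
    have b : (x : ℝ) ≤ 3 * K := by exact_mod_cast hx.2
    have h : 3 * (K : ℝ) ^ 2 ≤ (x : ℝ) * ((4 * K : ℕ) - x) := by
      push_cast
      linarith [mul_nonneg (sub_nonneg.2 a) (sub_nonneg.2 b)]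
    calc 81 * (K : ℝ) ^ 8 = (3 * (K : ℝ) ^ 2) ^ 4 := by ring
      _ ≤ ((x : ℝ) * ((4 * K : ℕ) - x)) ^ 4 := by gcongr
      _ = window (4 * K) x ^ 2 := by rw [window]; ring
  have h2 : ∑ x ∈ Finset.Icc K (3 * K), window (4 * K) x ^ 2 ≤
      ∑ x ∈ Finset.range (4 * K + 1), window (4 * K) x ^ 2 :=
    Finset.sum_le_sum_of_subset_of_nonneg
      (fun x hx => by rw [Finset.mem_Icc] at hx; rw [Finset.mem_range]; omega)
      (fun _ _ _ => sq_nonneg _)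
  refine le_trans ?_ (h1.trans h2)
  rw [Finset.sum_const, Nat.card_Icc, nsmul_eq_mul]
  have : ((3 * K + 1 - K : ℕ) : ℝ) = 2 * K + 1 := by
    rw [show 3 * K + 1 - K = 2 * K + 1 by omega]; push_cast; ring
  rw [this]
  have : (0 : ℝ) ≤ (K : ℝ) ^ 8 := by positivity
  linarith

/-- Second and first differences of the window. -/
theorem window_differences {K : ℕ} (hK : 1 ≤ K) {x : ℕ} (h0 : 0 < x) (hx : x < 4 * K) {p : ℝ}
    (hp0 : 0 ≤ p) (hp1 : p ≤ 1) :
    (1 - 2 * p) ^ 2 * ((window (4 * K) (x + 1) - window (4 * K) x) *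
        (window (4 * K) (x - 1) - window (4 * K) x)) +
      1 / 4 * (window (4 * K) (x + 1) - window (4 * K) (x - 1)) ^ 2 ≤
    1 / 4 * (1156 * (K : ℝ) ^ 4 + 16384 * p * (K : ℝ) ^ 6) := by
  have hKr : (1 : ℝ) ≤ K := by exact_mod_cast hK
  obtain ⟨y, rfl⟩ : ∃ y, x = y + 1 := ⟨x - 1, by omega⟩
  have hy0 : (0 : ℝ) ≤ y := by positivity
  have hyK : (y : ℝ) + 2 ≤ 4 * K := by
    have : y + 2 ≤ 4 * K := by omega
    exact_mod_cast this
  simp only [window, Nat.add_sub_cancel]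
  push_cast
  set k : ℝ := (K : ℝ)
  -- Coordinate centred at the middle 2k of the window: for x = y + 1 one has x(4k - x) = 4k² - z² =
  -- u, and the window is u².
  set z : ℝ := (y : ℝ) + 1 - 2 * k with hz
  have hzy : (y : ℝ) = z + 2 * k - 1 := by rw [hz]; ring
  have hz1 : -(2 * k) + 1 ≤ z := by rw [hz]; linarith
  have hz2 : z ≤ 2 * k - 1 := by rw [hz]; linarith
  set u : ℝ := 4 * k ^ 2 - z ^ 2 with hu
  have hzz : z ^ 2 ≤ 4 * k ^ 2 := by
    rw [show 4 * k ^ 2 = (2 * k) ^ 2 by ring]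
    exact sq_le_sq' (by linarith) (by linarith)
  have hk2 : 1 ≤ k ^ 2 := one_le_pow₀ hKr
  have e0 : ((y : ℝ) + 1) * (4 * k - (y + 1)) = u := by rw [hu, hzy]; ring
  have e1 : ((y : ℝ) + 1 + 1) * (4 * k - (y + 1 + 1)) = u - (2 * z + 1) := by
    rw [hu, hzy]; ring
  have e2 : (y : ℝ) * (4 * k - y) = u + (2 * z - 1) := by rw [hu, hzy]; ring
  rw [e0, e1, e2]
  have hu0 : 0 ≤ u := by rw [hu]; linarith
  have hu4 : u ≤ 4 * k ^ 2 := by rw [hu]; linarith [sq_nonneg z]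
  have hd2 : ((u - (2 * z + 1)) ^ 2 + (u + (2 * z - 1)) ^ 2 - 2 * u ^ 2) ^ 2 ≤
      1156 * k ^ 4 := by
    have : (u - (2 * z + 1)) ^ 2 + (u + (2 * z - 1)) ^ 2 - 2 * u ^ 2 =
        -4 * u + 8 * z ^ 2 + 2 := by ring
    rw [this]
    have : 1156 * k ^ 4 = (34 * k ^ 2) ^ 2 := by ring
    rw [this]
    have hz0 := sq_nonneg z
    exact sq_le_sq' (by linarith) (by linarith)
  have hd : ∀ b : ℝ, |b| ≤ 4 * k → 0 ≤ u + b → u + b ≤ 4 * k ^ 2 →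
      |(u + b) ^ 2 - u ^ 2| ≤ 32 * k ^ 3 := by
    intro b hb h0 h1
    have : (u + b) ^ 2 - u ^ 2 = b * (u + b + u) := by ring
    rw [this, abs_mul, abs_of_nonneg (add_nonneg h0 hu0)]
    calc |b| * (u + b + u) ≤ 4 * k * (8 * k ^ 2) :=
          mul_le_mul hb (by linarith) (by linarith) (by linarith)
      _ = 32 * k ^ 3 := by ring
  have ha := hd (-(2 * z + 1)) (by rw [abs_le]; constructor <;> linarith)
    (by rw [← sub_eq_add_neg, ← e1]; exact mul_nonneg (by linarith) (by linarith))
    (by rw [hu]; linarith [sq_nonneg (z + 1)])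
  have hb := hd (2 * z - 1) (by rw [abs_le]; constructor <;> linarith)
    (by rw [← e2]; exact mul_nonneg (by linarith) (by linarith))
    (by rw [hu]; linarith [sq_nonneg (z - 1)])
  rw [← sub_eq_add_neg] at ha
  set a := (u - (2 * z + 1)) ^ 2 - u ^ 2 with haa
  set b := (u + (2 * z - 1)) ^ 2 - u ^ 2 with hbb
  have hab : -(a * b) ≤ 1024 * k ^ 6 := by
    calc -(a * b) ≤ |a * b| := neg_le_abs _
      _ = |a| * |b| := abs_mul _ _
      _ ≤ (32 * k ^ 3) * (32 * k ^ 3) := mul_le_mul ha hb (abs_nonneg _) (by positivity)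
      _ = 1024 * k ^ 6 := by ring
  have hsum : (a + b) ^ 2 ≤ 1156 * k ^ 4 := by
    have : a + b = (u - (2 * z + 1)) ^ 2 + (u + (2 * z - 1)) ^ 2 - 2 * u ^ 2 := by
      rw [haa, hbb]; ring
    rw [this]; exact hd2
  have h4 : (u - (2 * z + 1)) ^ 2 - (u + (2 * z - 1)) ^ 2 = a - b := by rw [haa, hbb]; ring
  rw [h4]
  -- Since (1-2p)² = 1 - 4p(1-p), the expression separates into the squared second difference a + b,
  -- of order k⁴, and p(1-p) times a product of first differences, of order k⁶. This is what makes
  -- small p cheap.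
  have h5 : (1 - 2 * p) ^ 2 * (a * b) + 1 / 4 * (a - b) ^ 2 =
      1 / 4 * (a + b) ^ 2 + 4 * (p * (1 - p)) * -(a * b) := by ring
  have h6 : p * (1 - p) * -(a * b) ≤ p * (1024 * k ^ 6) := by
    have h7 : p * (1 - p) ≤ p := by linarith [mul_nonneg hp0 hp0]
    have h8 : 0 ≤ p * (1 - p) := mul_nonneg hp0 (by linarith)
    calc p * (1 - p) * -(a * b) ≤ p * (1 - p) * (1024 * k ^ 6) :=
          mul_le_mul_of_nonneg_left hab h8
      _ ≤ p * (1024 * k ^ 6) := mul_le_mul_of_nonneg_right h7 (by positivity)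
  rw [h5]
  linarith

/-! ### Controlled Grover iterations and the path operator. -/

section AmplitudeEstimation

variable {ι : Type} {D : ι → Type} {H : Type} [Fintype H] [DecidableEq H]

/-- The oracle-independent gate that changes the sign of the basis states where `s` holds. -/
def signGate (s : H → Prop) [DecidablePred s] : Gate D H :=
  .free ⟨signMatrix s, Matrix.mem_unitaryGroup_iff'.2 (by
    rw [Matrix.star_eq_conjTranspose, signMatrix_conjTranspose, signMatrix_mul_self])⟩

/-- One Grover iteration, performed if the control register holds a number larger than `t`. -/
def groverStep (L : ℕ) (B : List (Gate D H)) (h₀ : H) (good : H → Prop) [DecidablePred good]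
    (t : ℕ) : List (Gate D (Fin (L + 1) × H)) :=
  B.map (Gate.lift (Equiv.prodComm (Fin (L + 1)) H)) ++
    signGate (fun ω => t < (ω.1 : ℕ) ∧ good ω.2) ::
    ((circuitInv B).map (Gate.lift (Equiv.prodComm (Fin (L + 1)) H)) ++
      [signGate fun ω => t < (ω.1 : ℕ) ∧ ω.2 ≠ h₀])

theorem countP_isQuery_map_lift {Ω' R : Type} [Fintype Ω'] [DecidableEq Ω'] [DecidableEq R]
    (e : Ω' ≃ H × R) (L : List (Gate D H)) :
    (L.map (Gate.lift e)).countP Gate.isQuery = L.countP Gate.isQuery := by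
  rw [List.countP_map]
  congr 1
  ext g
  exact Gate.isQuery_lift e g

theorem countP_isQuery_circuitInv (L : List (Gate D H)) :
    (circuitInv L).countP Gate.isQuery = L.countP Gate.isQuery := by
  rw [circuitInv, List.countP_reverse, List.countP_map]
  congr 1
  ext g
  exact Gate.isQuery_inv g

theorem countP_isQuery_groverStep (L : ℕ) (B : List (Gate D H)) (h₀ : H) (good : H → Prop)
    [DecidablePred good] (t : ℕ) :
    (groverStep L B h₀ good t).countP Gate.isQuery = 2 * B.countP Gate.isQuery := by
  have h : ∀ (s : Fin (L + 1) × H → Prop) [DecidablePred s],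
      (signGate s : Gate D _).isQuery = false := fun _ _ => rfl
  simp only [groverStep, List.countP_append, List.countP_cons, countP_isQuery_map_lift,
    countP_isQuery_circuitInv, h, List.countP_nil]
  simp; ring

variable [∀ o, Fintype (D o)] [∀ o, DecidableEq (D o)] (O : ∀ o, Matrix.unitaryGroup (D o) ℂ)

/-- The reflection about the good subspace, conjugated by a circuit. -/
def goodReflection (B : List (Gate D H)) (good : H → Prop) [DecidablePred good] : Matrix H H ℂ :=
  (circuitMatrix O B)ᴴ * (signMatrix good * circuitMatrix O B)

theorem goodReflection_conjTranspose (B : List (Gate D H)) (good : H → Prop)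
    [DecidablePred good] : (goodReflection O B good)ᴴ = goodReflection O B good := by
  rw [goodReflection, Matrix.conjTranspose_mul, Matrix.conjTranspose_mul,
    Matrix.conjTranspose_conjTranspose, signMatrix_conjTranspose, Matrix.mul_assoc]

theorem goodReflection_mul_self (B : List (Gate D H)) (good : H → Prop)
    [DecidablePred good] : goodReflection O B good * goodReflection O B good = 1 := by
  set C := circuitMatrix O B with hC
  have h1 : Cᴴ * C = 1 := conjTranspose_mul_circuitMatrix O B
  have h2 : C * Cᴴ = 1 := mul_eq_one_comm.1 h1
  calc goodReflection O B good * goodReflection O B good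
      = Cᴴ * (signMatrix good * (C * Cᴴ) * signMatrix good * C) := by
        simp only [goodReflection, ← hC, Matrix.mul_assoc]
    _ = 1 := by rw [h2, Matrix.mul_one, signMatrix_mul_self, Matrix.one_mul, h1]

/-- The probability of the good basis states after a circuit. -/
def goodProb (B : List (Gate D H)) (h₀ : H) (good : H → Prop) [DecidablePred good] : ℝ :=
  ∑ h with good h, ‖run O B (Pi.single h₀ 1) h‖ ^ 2

theorem goodProb_nonneg (B : List (Gate D H)) (h₀ : H) (good : H → Prop) [DecidablePred good] :
    0 ≤ goodProb O B h₀ good :=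
  Finset.sum_nonneg fun _ _ => by positivity

theorem goodProb_le_one (B : List (Gate D H)) (h₀ : H) (good : H → Prop) [DecidablePred good] :
    goodProb O B h₀ good ≤ 1 := by
  rw [← nsq_single h₀, ← nsq_run O B]
  exact Finset.sum_le_sum_of_subset_of_nonneg (Finset.filter_subset _ _)
    fun _ _ _ => by positivity

/-- This entry is the expectation of the sign operator after the circuit. It is the constant c of
the Grover recurrence, which is how the path operator reads off p. -/
theorem goodReflection_apply_self (B : List (Gate D H)) (h₀ : H) (good : H → Prop)
    [DecidablePred good] :
    goodReflection O B good h₀ h₀ = ((1 - 2 * goodProb O B h₀ good : ℝ) : ℂ) := by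
  set C := circuitMatrix O B with hC
  set v : H → ℂ := run O B (Pi.single h₀ 1) with hv
  have hv' : v = C *ᵥ Pi.single h₀ 1 := run_eq_mulVec O B _
  have h1 : goodReflection O B good h₀ h₀ = star v ⬝ᵥ (signMatrix good *ᵥ v) := by
    rw [hv', Matrix.star_mulVec, ← Matrix.dotProduct_mulVec, Matrix.mulVec_mulVec,
      Matrix.mulVec_mulVec, goodReflection, ← hC]
    simp [Matrix.mul_assoc]
  have hone : ∑ h, ‖v h‖ ^ 2 = 1 := by
    have := nsq_run O B (Pi.single h₀ 1)
    rwa [nsq_single] at this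
  have h2 : ∀ h, star (v h) * (signMatrix good *ᵥ v) h =
      ((‖v h‖ ^ 2 - 2 * (if good h then ‖v h‖ ^ 2 else 0) : ℝ) : ℂ) := by
    intro h
    have h3 : star (v h) * v h = ((‖v h‖ ^ 2 : ℝ) : ℂ) := by
      rw [RCLike.star_def, Complex.conj_mul']; push_cast; rfl
    rw [signMatrix_mulVec_apply]
    split_ifs
    · rw [mul_neg, h3]; push_cast; ring
    · rw [h3]; push_cast; ring
  rw [h1]
  simp only [dotProduct, Pi.star_apply, h2]
  rw [← Complex.ofReal_sum, Finset.sum_sub_distrib, ← Finset.mul_sum, hone, ← Finset.sum_filter]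
  rfl

/-- Only the two sign gates are controlled. The circuit and its inverse are always applied and
cancel when the signs are not flipped, so no controlled oracles are needed. -/
theorem run_groverStep (L : ℕ) (B : List (Gate D H)) (h₀ : H) (good : H → Prop)
    [DecidablePred good] (t : ℕ) (Φ : Fin (L + 1) × H → ℂ) (ω : Fin (L + 1) × H) :
    run O (groverStep L B h₀ good t) Φ ω =
      if t < (ω.1 : ℕ) then
        (grover (goodReflection O B good) h₀ *ᵥ fun h => Φ (ω.1, h)) ω.2 else Φ ω := by
  obtain ⟨x, h⟩ := ω
  have hsign : ∀ (s : Fin (L + 1) × H → Prop) [DecidablePred s],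
      (signGate s : Gate D _).toMatrix O = signMatrix s := fun _ _ => rfl
  have hlift : ∀ (B' : List (Gate D H)) (Φ' : Fin (L + 1) × H → ℂ) (x' : Fin (L + 1)) (h' : H),
      run O (B'.map (Gate.lift (Equiv.prodComm (Fin (L + 1)) H))) Φ' (x', h') =
        run O B' (fun a => Φ' (x', a)) h' := fun B' Φ' x' h' => run_map_lift O _ B' Φ' (x', h')
  simp only [groverStep, run_append, run_cons, run_nil, hsign]
  rw [signMatrix_mulVec_apply, hlift, run_circuitInv]
  simp only [signMatrix_mulVec_apply, hlift]
  simp only [run_eq_mulVec]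
  set C := circuitMatrix O B with hC
  by_cases ht : t < (x : ℕ)
  · simp only [ht, true_and, if_true]
    rw [grover, ← Matrix.mulVec_mulVec, signMatrix_mulVec_apply, goodReflection, ← hC,
      ← Matrix.mulVec_mulVec, ← Matrix.mulVec_mulVec]
    have : (fun a => if good a then -(C *ᵥ fun a => Φ (x, a)) a else (C *ᵥ fun a => Φ (x, a)) a) =
        signMatrix good *ᵥ (C *ᵥ fun a => Φ (x, a)) := by
      ext a; rw [signMatrix_mulVec_apply]
    rw [this]
  · simp only [ht, false_and, if_false]
    change (Cᴴ *ᵥ (C *ᵥ fun a => Φ (x, a))) h = _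
    rw [Matrix.mulVec_mulVec, hC, conjTranspose_mul_circuitMatrix, Matrix.one_mulVec]

/-- The branch x of the control register takes part in the steps 0, …, x-1 only, so after all steps
it carries the x-th Grover iterate. -/
theorem run_groverSteps (L : ℕ) (B : List (Gate D H)) (h₀ : H) (good : H → Prop)
    [DecidablePred good] (w : ℕ → ℂ) (t : ℕ) :
    run O ((List.range t).flatMap (groverStep L B h₀ good))
        (fun ω => w (ω.1 : ℕ) * (Pi.single h₀ 1 : H → ℂ) ω.2) =
      fun ω => w (ω.1 : ℕ) *
        (grover (goodReflection O B good) h₀ ^ min (ω.1 : ℕ) t *ᵥ Pi.single h₀ 1) ω.2 := by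
  induction t with
  | zero =>
    simp only [List.range_zero, List.flatMap_nil, run_nil, Nat.min_zero, pow_zero,
      Matrix.one_mulVec]
  | succ t ih =>
    rw [List.range_succ, List.flatMap_append, run_append, ih, List.flatMap_singleton]
    ext ω
    rw [run_groverStep]
    split_ifs with ht
    · simp only
      rw [min_eq_right ht.le, min_eq_right (Nat.succ_le_of_lt ht), pow_succ',
        ← Matrix.mulVec_mulVec]
      have : (fun h => w (ω.1 : ℕ) *
          (grover (goodReflection O B good) h₀ ^ t *ᵥ Pi.single h₀ 1) h) =
          w (ω.1 : ℕ) • (grover (goodReflection O B good) h₀ ^ t *ᵥ Pi.single h₀ 1) := rfl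
      rw [this, Matrix.mulVec_smul]
      rfl
    · rw [min_eq_left (by omega), min_eq_left (by omega)]

/-- The deviation of the path operator from its expected value on a windowed Grover orbit. -/
theorem sum_nsq_path_le {V : Matrix H H ℂ} (hV : Vᴴ = V) (hVV : V * V = 1) (h₀ : H) {p : ℝ}
    (hp0 : 0 ≤ p) (hp1 : p ≤ 1) (hp : V h₀ h₀ = ((1 - 2 * p : ℝ) : ℂ)) {K : ℕ} (hK : 1 ≤ K)
    (x : Fin (4 * K + 1)) :
    nsq (fun h => (pathMatrix (4 * K) *ᵥ fun y => (window (4 * K) y : ℂ) *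
        (grover V h₀ ^ (y : ℕ) *ᵥ Pi.single h₀ 1) h) x -
      ((1 - 2 * p : ℝ) : ℂ) * ((window (4 * K) x : ℂ) *
        (grover V h₀ ^ (x : ℕ) *ᵥ Pi.single h₀ 1) h)) ≤
      1 / 4 * (1156 * (K : ℝ) ^ 4 + 16384 * p * (K : ℝ) ^ 6) := by
  have hKr : (1 : ℝ) ≤ K := by exact_mod_cast hK
  -- At the two ends the window vanishes and the path has one neighbour, so a single term remains;
  -- the neighbouring window value is at most (4K)².
  have hend : ∀ (x : ℕ) (b : ℝ), |b| ≤ 16 * K ^ 2 →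
      nsq (((1 / 2 * b : ℝ) : ℂ) • (grover V h₀ ^ x *ᵥ Pi.single h₀ 1)) ≤
        1 / 4 * (1156 * (K : ℝ) ^ 4 + 16384 * p * (K : ℝ) ^ 6) := by
    intro x b hb
    rw [← Matrix.mulVec_smul, nsq_mulVec (conjTranspose_mul_grover_pow hV hVV h₀ x)]
    have h1 : nsq (((1 / 2 * b : ℝ) : ℂ) • (Pi.single h₀ 1 : H → ℂ)) = 1 / 4 * b ^ 2 := by
      simp only [nsq, Pi.smul_apply, smul_eq_mul, norm_mul, mul_pow, ← Finset.mul_sum]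
      have := nsq_single h₀
      rw [nsq] at this
      rw [this, Complex.norm_real, Real.norm_eq_abs, sq_abs]
      ring
    have h2 : b ^ 2 ≤ (16 * (K : ℝ) ^ 2) ^ 2 := by
      rw [← sq_abs b]; gcongr
    have h3 : 0 ≤ 16384 * p * (K : ℝ) ^ 6 := by positivity
    have h4 : 0 ≤ (K : ℝ) ^ 4 := by positivity
    rw [h1]
    linarith
  have hx := x.2
  have hpath : ∀ h, (pathMatrix (4 * K) *ᵥ fun y => (window (4 * K) y : ℂ) *
        (grover V h₀ ^ (y : ℕ) *ᵥ Pi.single h₀ 1) h) x = _ := fun h =>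
    pathMatrix_mulVec (4 * K) (fun y => (window (4 * K) y : ℂ) *
        (grover V h₀ ^ (y : ℕ) *ᵥ Pi.single h₀ 1) h) x
  simp only [hpath]
  rcases Nat.eq_zero_or_pos (x : ℕ) with h0 | h0
  · have hw : window (4 * K) 0 = 0 := by simp [window]
    refine (le_of_eq ?_).trans (hend 1 (window (4 * K) 1) ?_)
    · congr 1
      ext h
      rw [h0, hw, if_pos (by omega), if_neg (by omega)]
      simp only [Pi.smul_apply, smul_eq_mul]
      push_cast
      ring
    · rw [window, abs_of_nonneg (sq_nonneg _)]
      push_cast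
      have : (1 * (4 * (K : ℝ) - 1)) ^ 2 ≤ (4 * K) ^ 2 :=
        pow_le_pow_left₀ (by linarith) (by linarith) 2
      linarith
  · rcases Nat.lt_or_ge (x : ℕ) (4 * K) with h1 | h1
    · refine (le_of_eq ?_).trans (window_differences hK h0 h1 hp0 hp1)
      obtain ⟨y, hy⟩ : ∃ y, (x : ℕ) = y + 1 := ⟨x - 1, by omega⟩
      rw [← nsq_grover_recurrence hV hVV h₀ hp ((x : ℕ) - 1)]
      congr 1
      ext h
      rw [if_pos h1, if_pos h0, hy]
      simp only [Nat.add_sub_cancel, Pi.sub_apply, Pi.add_apply, Pi.smul_apply, smul_eq_mul]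
      push_cast
      ring
    · have hxe : (x : ℕ) = 4 * K := by omega
      have hw : window (4 * K) (4 * K) = 0 := by simp [window]
      refine (le_of_eq ?_).trans (hend (4 * K - 1) (window (4 * K) (4 * K - 1)) ?_)
      · congr 1
        ext h
        rw [hxe, hw, if_neg (by omega), if_pos (by omega)]
        simp only [Pi.smul_apply, smul_eq_mul]
        push_cast
        ring
      · rw [window, abs_of_nonneg (sq_nonneg _), Nat.cast_sub (by omega)]
        push_cast
        have : ((4 * (K : ℝ) - 1) * (4 * K - (4 * K - 1))) ^ 2 ≤ (4 * K) ^ 2 :=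
          pow_le_pow_left₀ (by rw [sub_sub_cancel]; linarith) (by rw [sub_sub_cancel]; linarith) 2
        linarith

end AmplitudeEstimation

/-- Amplitude estimation: with `O(K)` uses of a circuit, the probability `p` of its good basis
states is estimated with mean square error `O(p / K ^ 2 + 1 / K ^ 4)`. -/
theorem exists_amplitudeEstimation {ι : Type} {D : ι → Type} [∀ o, Fintype (D o)]
    [∀ o, DecidableEq (D o)] {H : Type} [Fintype H] [DecidableEq H] (B : List (Gate D H)) (h₀ : H)
    (good : H → Prop) [DecidablePred good] {K : ℕ} (hK : 1 ≤ K) :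
    ∃ 𝒜 : QueryAlgorithm D, 𝒜.numQueries = 8 * K * B.countP Gate.isQuery ∧
      ∀ O : ∀ o, Matrix.unitaryGroup (D o) ℂ,
        ∑ ω, ‖𝒜.finalState O ω‖ ^ 2 * (𝒜.output ω - goodProb O B h₀ good) ^ 2 ≤
          3 / (K : ℝ) ^ 4 + 32 * goodProb O B h₀ good / (K : ℝ) ^ 2 := by
  have hKr : (1 : ℝ) ≤ K := by exact_mod_cast hK
  set Z : ℝ := ∑ x ∈ Finset.range (4 * K + 1), window (4 * K) x ^ 2 with hZ
  have hZge : 162 * (K : ℝ) ^ 9 ≤ Z := sum_window_sq_ge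
  have hZpos : 0 < Z := lt_of_lt_of_le (by positivity) hZge
  obtain ⟨W, hW⟩ := exists_unitary_mulVec_single (0 : Fin (4 * K + 1))
    (fun x => window (4 * K) x / Real.sqrt Z) (by
      simp only [div_pow, Real.sq_sqrt hZpos.le]
      rw [← Finset.sum_div, Fin.sum_univ_eq_sum_range (fun x => window (4 * K) x ^ 2), ← hZ,
        div_self hZpos.ne'])
  have hP := pathMatrix_isHermitian (4 * K)
  let 𝒜 : QueryAlgorithm D :=
    { Ω := Fin (4 * K + 1) × H
      init := (0, h₀)
      gates := Gate.lift (Equiv.refl (Fin (4 * K + 1) × H)) (.free W) ::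
        ((List.range (4 * K)).flatMap (groverStep (4 * K) B h₀ good) ++
          [Gate.lift (Equiv.refl (Fin (4 * K + 1) × H)) (.free hP.eigenvectorUnitary⁻¹)])
      -- The eigenvalue approximates 1 - 2p, and this inverts the relation.
      output := fun ω => (1 - hP.eigenvalues ω.1) / 2 }
  refine ⟨𝒜, ?_, fun O => ?_⟩
  · have hflat : ((List.range (4 * K)).flatMap (groverStep (4 * K) B h₀ good)).countP
        Gate.isQuery = 4 * K * (2 * B.countP Gate.isQuery) := by
      rw [List.countP_flatMap]
      have : (List.countP Gate.isQuery ∘ groverStep (4 * K) B h₀ good) =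
          fun _ => 2 * B.countP Gate.isQuery := by
        ext t; exact countP_isQuery_groverStep _ _ _ _ _
      rw [this]
      simp
    simp only [QueryAlgorithm.numQueries, 𝒜, List.countP_cons, List.countP_append, hflat,
      Gate.isQuery_lift, List.countP_nil]
    simp [Gate.isQuery]
    ring
  set p := goodProb O B h₀ good with hp
  have hp0 : 0 ≤ p := goodProb_nonneg O B h₀ good
  have hp1 : p ≤ 1 := goodProb_le_one O B h₀ good
  set V := goodReflection O B good with hV
  set v : ℕ → H → ℂ := fun y => grover V h₀ ^ y *ᵥ Pi.single h₀ 1 with hv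
  set w : ℕ → ℂ := fun y => ((window (4 * K) y / Real.sqrt Z : ℝ) : ℂ) with hw
  have hstate : ∀ y h, 𝒜.finalState O (y, h) =
      ((hP.eigenvectorUnitary : Matrix _ _ ℂ)ᴴ *ᵥ fun x : Fin (4 * K + 1) => w x * v x h) y := by
    intro y h
    have h1 : (Gate.lift (Equiv.refl (Fin (4 * K + 1) × H)) (.free W) : Gate D _).toMatrix O *ᵥ
        Pi.single (0, h₀) 1 =
        fun ω => w (ω.1 : ℕ) * (Pi.single h₀ 1 : H → ℂ) ω.2 := by
      ext ω
      rw [Gate.toMatrix_lift, kronecker_one_submatrix_mulVec]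
      have : (fun a => (Pi.single (0, h₀) 1 : Fin (4 * K + 1) × H → ℂ)
          ((Equiv.refl (Fin (4 * K + 1) × H)).symm
            (a, ((Equiv.refl (Fin (4 * K + 1) × H)) ω).2))) =
          (Pi.single h₀ 1 : H → ℂ) ω.2 • (Pi.single 0 1 : Fin (4 * K + 1) → ℂ) := by
        ext a
        by_cases ha : a = 0 <;> by_cases hb : ω.2 = h₀ <;> simp [Pi.single_apply, ha, hb]
      rw [this, Matrix.mulVec_smul]
      change (Pi.single h₀ 1 : H → ℂ) ω.2 • ((W : Matrix _ _ ℂ) *ᵥ (Pi.single 0 1 : Fin (4 * K + 1) → ℂ)) ω.1 = _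
      rw [hW, smul_eq_mul, mul_comm]
    rw [finalState_eq_run]
    change run O (Gate.lift (Equiv.refl (Fin (4 * K + 1) × H)) (.free W) ::
      ((List.range (4 * K)).flatMap (groverStep (4 * K) B h₀ good) ++
        [Gate.lift (Equiv.refl (Fin (4 * K + 1) × H)) (.free hP.eigenvectorUnitary⁻¹)]))
      (Pi.single (0, h₀) 1) (y, h) = _
    rw [run_cons, h1, run_append, run_groverSteps, run_cons, run_nil, Gate.toMatrix_lift,
      kronecker_one_submatrix_mulVec]
    change ((hP.eigenvectorUnitary : Matrix _ _ ℂ)ᴴ *ᵥ fun x : Fin (4 * K + 1) =>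
      w x * (grover V h₀ ^ min (x : ℕ) (4 * K) *ᵥ Pi.single h₀ 1) h) y = _
    have : ∀ x : Fin (4 * K + 1), min (x : ℕ) (4 * K) = x := fun x =>
      min_eq_left (Nat.lt_succ_iff.1 x.2)
    simp only [this, hv]
  have hterm : ∀ y h, ‖𝒜.finalState O (y, h)‖ ^ 2 * (𝒜.output (y, h) - p) ^ 2 =
      1 / 4 * (‖((hP.eigenvectorUnitary : Matrix _ _ ℂ)ᴴ *ᵥ
        fun x : Fin (4 * K + 1) => w x * v x h) y‖ ^ 2 *
          (hP.eigenvalues y - (1 - 2 * p)) ^ 2) := by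
    intro y h
    rw [hstate]
    change _ * ((1 - hP.eigenvalues y) / 2 - p) ^ 2 = _
    ring
  have hx : ∀ x : Fin (4 * K + 1), ∑ h, ‖(pathMatrix (4 * K) *ᵥ
      (fun x : Fin (4 * K + 1) => w x * v x h) -
        ((1 - 2 * p : ℝ) : ℂ) • fun x : Fin (4 * K + 1) => w x * v x h) x‖ ^ 2 ≤
      1 / Z * (1 / 4 * (1156 * (K : ℝ) ^ 4 + 16384 * p * (K : ℝ) ^ 6)) := by
    intro x
    refine le_trans (le_of_eq ?_) (mul_le_mul_of_nonneg_left
      (sum_nsq_path_le (goodReflection_conjTranspose O B good) (goodReflection_mul_self O B good)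
        h₀ hp0 hp1 (goodReflection_apply_self O B h₀ good) hK x)
      (by positivity : 0 ≤ 1 / Z))
    rw [nsq, Finset.mul_sum]
    refine Finset.sum_congr rfl fun h _ => ?_
    have hwv : (fun x : Fin (4 * K + 1) => w x * v x h) = (((1 / Real.sqrt Z : ℝ)) : ℂ) •
        fun x : Fin (4 * K + 1) => (window (4 * K) x : ℂ) * v x h := by
      ext x
      simp only [hw, Pi.smul_apply, smul_eq_mul]
      push_cast
      ring
    rw [hwv, Matrix.mulVec_smul, smul_comm, ← smul_sub, Pi.smul_apply, smul_eq_mul, norm_mul,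
      mul_pow, Complex.norm_real, Real.norm_eq_abs, sq_abs, div_pow, one_pow,
      Real.sq_sqrt hZpos.le]
    rfl
  calc ∑ ω, ‖𝒜.finalState O ω‖ ^ 2 * (𝒜.output ω - p) ^ 2
      = ∑ y : Fin (4 * K + 1), ∑ h : H,
          ‖𝒜.finalState O (y, h)‖ ^ 2 * (𝒜.output (y, h) - p) ^ 2 :=
        Fintype.sum_prod_type (f := fun ω : Fin (4 * K + 1) × H =>
          ‖𝒜.finalState O ω‖ ^ 2 * (𝒜.output ω - p) ^ 2)
    _ = 1 / 4 * ∑ x : Fin (4 * K + 1), ∑ h, ‖(pathMatrix (4 * K) *ᵥ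
          (fun x : Fin (4 * K + 1) => w x * v x h) -
          ((1 - 2 * p : ℝ) : ℂ) • fun x : Fin (4 * K + 1) => w x * v x h) x‖ ^ 2 := by
        simp only [hterm, ← Finset.mul_sum]
        rw [Finset.sum_comm]
        congr 1
        simp only [sum_eigenvalues_sub_sq]
        exact Finset.sum_comm
    _ ≤ 1 / 4 * ∑ x : Fin (4 * K + 1),
          1 / Z * (1 / 4 * (1156 * (K : ℝ) ^ 4 + 16384 * p * (K : ℝ) ^ 6)) := by
        gcongr with x
        exact hx x
    _ = (4 * K + 1) * (1156 * (K : ℝ) ^ 4 + 16384 * p * (K : ℝ) ^ 6) / (16 * Z) := by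
        rw [Finset.sum_const, Finset.card_univ, Fintype.card_fin, nsmul_eq_mul]
        push_cast
        field_simp
        ring
    -- The 16 collects the 1/4 from halving the eigenvalue and the 1/4 in the deviation bound. The
    -- powers balance as K·K⁴/K⁹ and K·K⁶/K⁹.
    _ ≤ (5 * K) * (1156 * (K : ℝ) ^ 4 + 16384 * p * (K : ℝ) ^ 6) / (16 * (162 * K ^ 9)) := by
        gcongr
        linarith
    _ = 5 * 1156 / 2592 / (K : ℝ) ^ 4 + 5 * 16384 / 2592 * p / (K : ℝ) ^ 2 := by
        have : (K : ℝ) ≠ 0 := by positivity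
        field_simp
        ring
    _ ≤ 3 / (K : ℝ) ^ 4 + 32 * p / (K : ℝ) ^ 2 := by
        gcongr
        · norm_num
        · norm_num

/-! ### The circuit of a group -/

section GroupCircuit

variable {n J : ℕ} {m : Fin J → ℕ}

/-- The basis of the register of the `SELECT` oracle of a group. -/
abbrev SelectBasis (n N : ℕ) : Type := Fin (N + 1) × Fin 2 × Qubits n × Fin (N + 1)

/-- State preparation on the register of `SELECT`. -/
def stateGate (n : ℕ) (m : Fin J → ℕ) (j : Fin J) : Gate (Register n m) (SelectBasis n (m j)) :=
  .query .state false (Fin (m j + 1) × Fin 2 × Fin (m j + 1))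
    { toFun := fun p => (p.2.2.1, p.1, p.2.1, p.2.2.2)
      invFun := fun p => (p.2.1, p.2.2.1, p.1, p.2.2.2)
      left_inv := fun _ => rfl
      right_inv := fun _ => rfl }

/-- `PREPARE` or its inverse on the register of `SELECT`. -/
def prepareGate (n : ℕ) (m : Fin J → ℕ) (j : Fin J) (inverse : Bool) :
    Gate (Register n m) (SelectBasis n (m j)) :=
  .query (.prepare j) inverse (Qubits n × Fin (m j + 1))
    (Equiv.prodAssoc (Fin (m j + 1)) (Fin 2) (Qubits n × Fin (m j + 1))).symm

/-- `SELECT` on its register. -/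
def selectGate (n : ℕ) (m : Fin J → ℕ) (j : Fin J) : Gate (Register n m) (SelectBasis n (m j)) :=
  .query (.select j) false Unit (Equiv.prodPUnit (SelectBasis n (m j))).symm

/-- The circuit that encodes the expectation values of a group in its amplitudes. -/
def groupCircuit (n : ℕ) (m : Fin J → ℕ) (j : Fin J) :
    List (Gate (Register n m) (SelectBasis n (m j))) :=
  [stateGate n m j, prepareGate n m j false, selectGate n m j, prepareGate n m j true]

theorem countP_isQuery_groupCircuit (n : ℕ) (m : Fin J → ℕ) (j : Fin J) :
    (groupCircuit n m j).countP Gate.isQuery = 4 := rfl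

/-- The basis states in which `PREPARE` is undone and a term outside `I` is recorded. -/
def IsRecorded {N : ℕ} (I : Finset (Fin N)) (p : SelectBasis n N) : Prop :=
  p.1 = 0 ∧ p.2.1 = 0 ∧ ∃ k ∈ Iᶜ, p.2.2.2 = k.succ

instance {N : ℕ} (I : Finset (Fin N)) : DecidablePred (IsRecorded (n := n) I) := fun p =>
  inferInstanceAs (Decidable (p.1 = 0 ∧ p.2.1 = 0 ∧ ∃ k ∈ Iᶜ, p.2.2.2 = k.succ))

theorem nsq_mulVec_of_isStarProjection {P : Matrix (Qubits n) (Qubits n) ℂ}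
    (hP : IsStarProjection P) (ψ : Qubits n → ℂ) : nsq (P *ᵥ ψ) = expVal ψ P := by
  have h1 : Pᴴ * P = P := by
    have h2 : Pᴴ = P := hP.isSelfAdjoint
    rw [h2]
    exact hP.isIdempotentElem
  have h : (nsq (P *ᵥ ψ) : ℂ) = star ψ ⬝ᵥ (P *ᵥ ψ) := by
    rw [nsq_eq_dotProduct, Matrix.star_mulVec, ← Matrix.dotProduct_mulVec, Matrix.mulVec_mulVec,
      h1]
  rw [expVal, ← h, Complex.ofReal_re]

theorem sum_isRecorded {N : ℕ} (I : Finset (Fin N)) (f : SelectBasis n N → ℝ) :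
    ∑ p with IsRecorded I p, f p = ∑ k ∈ Iᶜ, ∑ q, f (0, 0, q, k.succ) := by
  rw [← Finset.sum_product']
  symm
  refine Finset.sum_nbij (fun a => (0, 0, a.2, a.1.succ)) ?_ ?_ ?_ (fun _ _ => rfl)
  · intro a ha
    rw [Finset.mem_filter]
    exact ⟨Finset.mem_univ _, rfl, rfl, a.1, (Finset.mem_product.1 ha).1, rfl⟩
  · intro a _ b _ hab
    simp only [Prod.mk.injEq, Fin.succ_inj, true_and] at hab
    exact Prod.ext hab.2 hab.1
  · rintro ⟨x, y, q, l⟩ hp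
    obtain ⟨_, h1, h2, k, hk, h3⟩ := Finset.mem_filter.1 hp
    refine ⟨(k, q), Finset.mem_coe.2 (Finset.mem_product.2 ⟨hk, Finset.mem_univ _⟩), ?_⟩
    simp only at h1 h2 h3
    rw [h1, h2, h3]

variable {β : (j : Fin J) → Fin (m j) → ℝ} {I T : (j : Fin J) → Finset (Fin (m j))}
  {Pr : (j : Fin J) → Fin (m j) → Matrix (Qubits n) (Qubits n) ℂ} {ψ : Qubits n → ℂ}
  {O : ∀ o : OracleName J, Matrix.unitaryGroup (Register n m o) ℂ}

/-- The amplitude of a term in the state loaded by `PREPARE`. -/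
def prepareAmplitude {N : ℕ} (b : Fin N → ℝ) (s : Finset (Fin N)) (k : Fin N) : ℝ :=
  |b k| ^ (1 / 4 : ℝ) / (Real.sqrt 2 * Real.sqrt (sqrtSum b s))

theorem sqrtSum_nonneg {N : ℕ} (b : Fin N → ℝ) (s : Finset (Fin N)) : 0 ≤ sqrtSum b s :=
  Finset.sum_nonneg fun _ _ => Real.sqrt_nonneg _

/-- The amplitude enters squared, once through PREPARE and once through its inverse; the 2 comes
from summing over the bit y. -/
theorem two_mul_prepareAmplitude_sq {N : ℕ} (b : Fin N → ℝ) (s : Finset (Fin N)) (k : Fin N) :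
    2 * prepareAmplitude b s k ^ 2 = Real.sqrt |b k| / sqrtSum b s := by
  have h : (|b k| ^ (1 / 4 : ℝ)) ^ 2 = Real.sqrt |b k| := by
    rw [← Real.rpow_natCast, ← Real.rpow_mul (abs_nonneg _), Real.sqrt_eq_rpow]
    norm_num
  rw [prepareAmplitude, div_pow, mul_pow, h, Real.sq_sqrt (by norm_num),
    Real.sq_sqrt (sqrtSum_nonneg b s)]
  ring

/-- Projecting back onto the prepared state sums over y. The sign from Z turns the two branches into
ψ - Rψ = 2Πψ, while the index copied by SELECT prevents interference between different k. -/
theorem run_groupCircuit (hO : IsAccess β T Pr ψ O) (j : Fin J) (hT : sqrtSum (β j) (T j) ≠ 0)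
    (q : Qubits n) (k : Fin (m j)) (hk : k ∈ T j) :
    run O (groupCircuit n m j) (Pi.single (0, 0, 0, 0) 1) (0, 0, q, k.succ) =
      ((Real.sqrt |β j k| / sqrtSum (β j) (T j) : ℝ) : ℂ) * (Pr j k *ᵥ ψ) q := by
  set a : Fin (m j) → ℝ := prepareAmplitude (β j) (T j) with ha
  set P : Matrix (Fin (m j + 1) × Fin 2) (Fin (m j + 1) × Fin 2) ℂ :=
    (O (.prepare j) : Matrix (Fin (m j + 1) × Fin 2) (Fin (m j + 1) × Fin 2) ℂ) with hP
  have hprep : P *ᵥ Pi.single (0, 0) 1 = ∑ k ∈ T j, ∑ y : Fin 2,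
      (a k : ℂ) • (Pi.single (k.succ, y) 1 : Fin (m j + 1) × Fin 2 → ℂ) := hO.prepare j hT
  have h1 : (stateGate n m j).toMatrix O *ᵥ Pi.single (0, 0, 0, 0) 1 = selectKet 0 0 ψ 0 := by
    ext p
    refine (kronecker_one_submatrix_mulVec _ _ _ _).trans ?_
    have : (fun a : Qubits n => (Pi.single (0, 0, 0, 0) 1 : SelectBasis n (m j) → ℂ)
        (p.1, p.2.1, a, p.2.2.2)) =
        (if p.1 = 0 ∧ p.2.1 = 0 ∧ p.2.2.2 = 0 then 1 else 0 : ℂ) • Pi.single 0 1 := by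
      ext a
      simp only [Pi.single_apply, Prod.mk.injEq, Pi.smul_apply, smul_eq_mul]
      split_ifs <;> simp_all
    change ((O .state : Matrix (Qubits n) (Qubits n) ℂ) *ᵥ fun a : Qubits n =>
      (Pi.single (0, 0, 0, 0) 1 : SelectBasis n (m j) → ℂ) (p.1, p.2.1, a, p.2.2.2)) p.2.2.1 = _
    rw [this, Matrix.mulVec_smul, hO.state, Pi.smul_apply, selectKet]
    split_ifs <;> simp
  have h2 : (prepareGate n m j false).toMatrix O *ᵥ selectKet 0 0 ψ 0 =
      ∑ k ∈ T j, ∑ y : Fin 2, (a k : ℂ) • selectKet k.succ y ψ 0 := by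
    ext p
    refine (kronecker_one_submatrix_mulVec _ _ _ _).trans ?_
    change (P *ᵥ fun x : Fin (m j + 1) × Fin 2 =>
      (selectKet 0 0 ψ 0 : SelectBasis n (m j) → ℂ) (x.1, x.2, p.2.2)) (p.1, p.2.1) = _
    have : (fun x : Fin (m j + 1) × Fin 2 =>
        (selectKet 0 0 ψ 0 : SelectBasis n (m j) → ℂ) (x.1, x.2, p.2.2)) =
        (if p.2.2.2 = 0 then ψ p.2.2.1 else 0 : ℂ) • Pi.single (0, 0) 1 := by
      ext x
      obtain ⟨x, y⟩ := x
      simp only [selectKet, Pi.single_apply, Prod.mk.injEq, Pi.smul_apply, smul_eq_mul]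
      split_ifs <;> simp_all
    rw [this, Matrix.mulVec_smul, hprep]
    simp only [Pi.smul_apply, Finset.sum_apply, Finset.mul_sum, smul_eq_mul, selectKet]
    refine Finset.sum_congr rfl fun k _ => Finset.sum_congr rfl fun y _ => ?_
    simp only [Pi.single_apply, Prod.ext_iff]
    split_ifs <;> simp_all
    ring
  have h3 : (selectGate n m j).toMatrix O *ᵥ
      (∑ k ∈ T j, ∑ y : Fin 2, (a k : ℂ) • selectKet k.succ y ψ 0) =
      ∑ k ∈ T j, ∑ y : Fin 2, (a k : ℂ) • (-1 : ℂ) ^ (y : ℕ) •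
        selectKet k.succ y ((1 - 2 • Pr j k) ^ (y : ℕ) *ᵥ ψ) k.succ := by
    have : ∀ Φ : SelectBasis n (m j) → ℂ, (selectGate n m j).toMatrix O *ᵥ Φ =
        (O (.select j) : Matrix (SelectBasis n (m j)) (SelectBasis n (m j)) ℂ) *ᵥ Φ := fun Φ => by
      ext p
      exact kronecker_one_submatrix_mulVec _ _ _ _
    rw [this, Matrix.mulVec_sum]
    refine Finset.sum_congr rfl fun k hk => ?_
    rw [Matrix.mulVec_sum]
    refine Finset.sum_congr rfl fun y _ => ?_
    rw [Matrix.mulVec_smul, hO.select_zero j k hk y ψ]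
  set Φ : SelectBasis n (m j) → ℂ := ∑ k ∈ T j, ∑ y : Fin 2, (a k : ℂ) • (-1 : ℂ) ^ (y : ℕ) •
        selectKet k.succ y ((1 - 2 • Pr j k) ^ (y : ℕ) *ᵥ ψ) k.succ with hΦ
  have hslice : ∀ k' ∈ T j, ∀ y : Fin 2, Φ (k'.succ, y, q, k.succ) =
      if k' = k then (a k : ℂ) * ((-1 : ℂ) ^ (y : ℕ) *
        ((1 - 2 • Pr j k) ^ (y : ℕ) *ᵥ ψ) q) else 0 := by
    intro k' hk' y
    simp only [hΦ, Finset.sum_apply, Pi.smul_apply, smul_eq_mul, selectKet, Fin.succ_inj]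
    rw [Finset.sum_eq_single k, Finset.sum_eq_single y]
    · by_cases h : k' = k
      · subst h; simp
      · simp [h]
    · intro b _ hb; simp [Ne.symm hb]
    · simp
    · intro b _ hb; simp [Ne.symm hb]
    · exact fun h => absurd hk h
  have h4 : ((prepareGate n m j true).toMatrix O *ᵥ Φ) (0, 0, q, k.succ) =
      star (P *ᵥ Pi.single (0, 0) 1) ⬝ᵥ fun x => Φ (x.1, x.2, q, k.succ) := by
    refine (kronecker_one_submatrix_mulVec _ _ _ _).trans ?_
    change (Pᴴ *ᵥ fun x : Fin (m j + 1) × Fin 2 => Φ (x.1, x.2, q, k.succ)) (0, 0) = _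
    rw [Matrix.mulVec_single_one]
    rfl
  have h5 : star (P *ᵥ Pi.single (0, 0) 1) ⬝ᵥ (fun x => Φ (x.1, x.2, q, k.succ)) =
      ∑ k' ∈ T j, ∑ y : Fin 2, (a k' : ℂ) * Φ (k'.succ, y, q, k.succ) := by
    rw [hprep, star_sum, sum_dotProduct]
    refine Finset.sum_congr rfl fun k' _ => ?_
    rw [star_sum, sum_dotProduct]
    refine Finset.sum_congr rfl fun y _ => ?_
    rw [star_smul, smul_dotProduct, ← Pi.single_star, star_one, single_dotProduct, one_mul,
      smul_eq_mul]
    simp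
  rw [groupCircuit, run_cons, run_cons, run_cons, run_cons, run_nil, h1, h2, h3, h4, h5,
    Finset.sum_eq_single k]
  · simp only [hslice k hk, if_true, Fin.sum_univ_two]
    have hR : ((1 - 2 • Pr j k) *ᵥ ψ) q = ψ q - 2 * (Pr j k *ᵥ ψ) q := by
      rw [Matrix.sub_mulVec, Matrix.one_mulVec, Pi.sub_apply, Matrix.smul_mulVec, Pi.smul_apply,
        nsmul_eq_mul]
      norm_num
    have h2a := two_mul_prepareAmplitude_sq (β j) (T j) k
    rw [← h2a]
    simp only [Fin.val_zero, Fin.val_one, pow_zero, pow_one, hR, Matrix.one_mulVec]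
    push_cast
    ring
  · intro k' hk' hne
    simp [hslice k' hk', hne]
  · exact fun h => absurd hk h

/-- Squaring the amplitude turns √|β| into |β| and ‖Πψ‖² into the expectation value; the sum runs
over the indices outside I, the normalization over T. -/
theorem goodProb_groupCircuit (hO : IsAccess β T Pr ψ O) (hPr : ∀ j k, IsStarProjection (Pr j k))
    (j : Fin J) (hIT : (I j)ᶜ ⊆ T j) (hT : sqrtSum (β j) (T j) ≠ 0) :
    goodProb O (groupCircuit n m j) (0, 0, 0, 0) (IsRecorded (I j)) =
      (∑ k ∈ (I j)ᶜ, |β j k| * expVal ψ (Pr j k)) / sqrtSum (β j) (T j) ^ 2 := by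
  rw [goodProb, sum_isRecorded, Finset.sum_div]
  refine Finset.sum_congr rfl fun k hk => ?_
  simp only [run_groupCircuit hO j hT _ k (hIT hk), norm_mul, mul_pow, ← Finset.mul_sum]
  rw [← nsq_mulVec_of_isStarProjection (hPr j k), Complex.norm_real, Real.norm_eq_abs, sq_abs,
    div_pow, Real.sq_sqrt (abs_nonneg _), nsq]
  ring

end GroupCircuit

/-! ### Estimation of a group with constant success probability -/

theorem sqrtSum_mono {N : ℕ} (b : Fin N → ℝ) {s t : Finset (Fin N)} (h : s ⊆ t) :
    sqrtSum b s ≤ sqrtSum b t :=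
  Finset.sum_le_sum_of_subset_of_nonneg h fun _ _ _ => Real.sqrt_nonneg _

theorem eq_zero_of_sqrtSum_eq_zero {N : ℕ} {b : Fin N → ℝ} {s : Finset (Fin N)}
    (h : sqrtSum b s = 0) {k : Fin N} (hk : k ∈ s) : b k = 0 := by
  have := (Finset.sum_eq_zero_iff_of_nonneg fun _ _ => Real.sqrt_nonneg _).1 h k hk
  rwa [Real.sqrt_eq_zero (abs_nonneg _), abs_eq_zero] at this

theorem expVal_nonneg {n : ℕ} {P : Matrix (Qubits n) (Qubits n) ℂ} (hP : IsStarProjection P)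
    (ψ : Qubits n → ℂ) : 0 ≤ expVal ψ P := by
  rw [← nsq_mulVec_of_isStarProjection hP]; exact nsq_nonneg _

/-- The algorithm without gates that outputs `0`. -/
def trivialAlgorithm {ι : Type} (D : ι → Type) : QueryAlgorithm D where
  Ω := Unit
  init := ()
  gates := []
  output := fun _ => 0

/-- The weighted sum of the expectation values of the projectors of a group outside `I`. -/
def remainingSum {n N : ℕ} (b : Fin N → ℝ) (I : Finset (Fin N))
    (Pr : Fin N → Matrix (Qubits n) (Qubits n) ℂ) (ψ : Qubits n → ℂ) : ℝ :=
  ∑ k ∈ Iᶜ, |b k| * expVal ψ (Pr k)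

-- Chebyshev's inequality for amplitude estimation, with the number of iterations chosen from the a
-- priori bound P. The algorithm must not depend on the oracles, so P and not p fixes that number.
open Classical in
theorem exists_groupEstimator {n J : ℕ} {m : Fin J → ℕ} (β : (j : Fin J) → Fin (m j) → ℝ)
    (I T : (j : Fin J) → Finset (Fin (m j))) (j : Fin J) (hIT : (I j)ᶜ ⊆ T j) {P η : ℝ}
    (hP1 : P ≤ 1 / 4) (hη0 : 0 ≤ η) (hη : sqrtSum (β j) (T j) ≠ 0 → 0 < η) :
    ∃ 𝒜 : QueryAlgorithm (Register n m), (𝒜.numQueries : ℝ) ≤ 4096 * (Real.sqrt P / η) ∧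
      ∀ (Pr : (j : Fin J) → Fin (m j) → Matrix (Qubits n) (Qubits n) ℂ) (ψ : Qubits n → ℂ)
        (O : ∀ o : OracleName J, Matrix.unitaryGroup (Register n m o) ℂ),
        (∀ j k, IsStarProjection (Pr j k)) → IsAccess β T Pr ψ O →
        remainingSum (β j) (I j) (Pr j) ψ ≤ sqrtSum (β j) (I j)ᶜ ^ 2 * P →
        ∑ ω with ¬ |𝒜.output ω - remainingSum (β j) (I j) (Pr j) ψ| ≤
            sqrtSum (β j) Finset.univ ^ 2 * η / 2, ‖𝒜.finalState O ω‖ ^ 2 ≤ 1 / 16 := by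
  set N : ℝ := sqrtSum (β j) Finset.univ ^ 2 with hN
  have hN0 : 0 ≤ N := sq_nonneg _
  -- In both cases 0 is already accurate enough: either all coefficients outside I vanish, or the
  -- value is at most N·P < N·η/2 up to equality when N = 0.
  by_cases htriv : sqrtSum (β j) (T j) = 0 ∨ P < η / 2
  · refine ⟨trivialAlgorithm _, ?_, fun Pr ψ O hPr hO hX => ?_⟩
    · have : (trivialAlgorithm (Register n m)).numQueries = 0 := rfl
      rw [this]
      push_cast
      positivity
    · have hX0 : 0 ≤ remainingSum (β j) (I j) (Pr j) ψ :=
        Finset.sum_nonneg fun k _ => mul_nonneg (abs_nonneg _) (expVal_nonneg (hPr j k) ψ)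
      have hgood : |0 - remainingSum (β j) (I j) (Pr j) ψ| ≤ N * η / 2 := by
        rw [zero_sub, abs_neg, abs_of_nonneg hX0]
        rcases htriv with h | h
        · have : remainingSum (β j) (I j) (Pr j) ψ = 0 :=
            Finset.sum_eq_zero fun k hk => by
              rw [eq_zero_of_sqrtSum_eq_zero h (hIT hk)]; simp
          rw [this]; positivity
        · have h1 : sqrtSum (β j) (I j)ᶜ ^ 2 ≤ N :=
            pow_le_pow_left₀ (sqrtSum_nonneg _ _) (sqrtSum_mono _ (Finset.subset_univ _)) 2
          calc _ ≤ sqrtSum (β j) (I j)ᶜ ^ 2 * P := hX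
            _ ≤ sqrtSum (β j) (I j)ᶜ ^ 2 * (η / 2) :=
                mul_le_mul_of_nonneg_left h.le (sq_nonneg _)
            _ ≤ N * (η / 2) := mul_le_mul_of_nonneg_right h1 (by positivity)
            _ = N * η / 2 := by ring
      rw [Finset.sum_eq_zero]
      · norm_num
      · intro ω hω
        exact absurd hgood (Finset.mem_filter.1 hω).2
  push Not at htriv
  obtain ⟨hT, hPη⟩ := htriv
  have hηpos := hη hT
  have hP0 : 0 < P := by linarith
  have hsqrt : Real.sqrt P * Real.sqrt P = P := Real.mul_self_sqrt hP0.le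
  have hs0 : 0 < Real.sqrt P := Real.sqrt_pos.2 hP0
  have hshalf : Real.sqrt P ≤ 1 / 2 := by
    rw [Real.sqrt_le_left (by norm_num)]; norm_num; linarith
  -- From η/2 ≤ P = √P·√P ≤ √P/2. This lets the rounding in K be absorbed into the query bound.
  have hratio : 1 ≤ Real.sqrt P / η := by
    rw [one_le_div hηpos]
    have := mul_le_mul_of_nonneg_left hshalf hs0.le
    linarith
  -- The factor 64 makes each of the two error terms at most η²/128; dividing their sum by (η/2)²
  -- gives 1/16.
  set K : ℕ := ⌈64 * (Real.sqrt P / η)⌉₊ with hKdef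
  have hKge : 64 * (Real.sqrt P / η) ≤ K := Nat.le_ceil _
  have hKle : (K : ℝ) ≤ 64 * (Real.sqrt P / η) + 1 := (Nat.ceil_lt_add_one (by positivity)).le
  have hK1 : 1 ≤ K := Nat.one_le_iff_ne_zero.2 fun h => by
    rw [h] at hKge
    push_cast at hKge
    linarith
  obtain ⟨𝒜, hq, hvar⟩ := exists_amplitudeEstimation (groupCircuit n m j) (0, 0, 0, 0)
    (IsRecorded (I j)) hK1
  refine ⟨{ 𝒜 with output := fun ω => sqrtSum (β j) (T j) ^ 2 * 𝒜.output ω }, ?_,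
    fun Pr ψ O hPr hO hX => ?_⟩
  · change (𝒜.numQueries : ℝ) ≤ _
    rw [hq, countP_isQuery_groupCircuit]
    push_cast
    linarith
  have hST : 0 < sqrtSum (β j) (T j) := lt_of_le_of_ne (sqrtSum_nonneg _ _) (Ne.symm hT)
  have hp := goodProb_groupCircuit hO hPr j hIT hT
  have hv := hvar O
  change _ = remainingSum (β j) (I j) (Pr j) ψ / _ at hp
  set X := remainingSum (β j) (I j) (Pr j) ψ with hXdef
  set p := goodProb O (groupCircuit n m j) (0, 0, 0, 0) (IsRecorded (I j)) with hpdef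
  have hXp : X = sqrtSum (β j) (T j) ^ 2 * p := by rw [hp]; field_simp
  have hpP : p ≤ P := by
    rw [hp, div_le_iff₀ (by positivity), mul_comm]
    refine hX.trans (mul_le_mul_of_nonneg_right ?_ hP0.le)
    exact pow_le_pow_left₀ (sqrtSum_nonneg _ _) (sqrtSum_mono _ hIT) 2
  have hTN : sqrtSum (β j) (T j) ^ 2 ≤ N :=
    pow_le_pow_left₀ (sqrtSum_nonneg _ _) (sqrtSum_mono _ (Finset.subset_univ _)) 2
  have hfar : ∀ ω, ¬ |sqrtSum (β j) (T j) ^ 2 * 𝒜.output ω - X| ≤ N * η / 2 →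
      η ^ 2 / 4 ≤ (𝒜.output ω - p) ^ 2 := by
    intro ω h
    rw [hXp, ← mul_sub, abs_mul, abs_of_nonneg (sq_nonneg _)] at h
    have h1 : η / 2 ≤ |𝒜.output ω - p| := by
      by_contra hlt
      push Not at hlt
      apply h
      calc _ ≤ N * (η / 2) := mul_le_mul hTN hlt.le (abs_nonneg _) hN0
        _ = N * η / 2 := by ring
    rw [← sq_abs (𝒜.output ω - p)]
    calc η ^ 2 / 4 = (η / 2) ^ 2 := by ring
      _ ≤ _ := pow_le_pow_left₀ (by positivity) h1 2
  have hmarkov : (η ^ 2 / 4) * ∑ ω with ¬ |sqrtSum (β j) (T j) ^ 2 * 𝒜.output ω - X| ≤ N * η / 2,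
      ‖𝒜.finalState O ω‖ ^ 2 ≤ 3 / (K : ℝ) ^ 4 + 32 * p / (K : ℝ) ^ 2 := by
    refine le_trans ?_ hv
    rw [Finset.mul_sum]
    refine le_trans (Finset.sum_le_sum fun ω hω => ?_)
      (Finset.sum_le_sum_of_subset_of_nonneg (Finset.filter_subset _ _) fun _ _ _ => by positivity)
    rw [mul_comm]
    exact mul_le_mul_of_nonneg_left (hfar ω (Finset.mem_filter.1 hω).2) (by positivity)
  have hKr : (0 : ℝ) < K := by exact_mod_cast hK1
  have hK2 : 4096 * P / η ^ 2 ≤ (K : ℝ) ^ 2 := by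
    calc 4096 * P / η ^ 2 = (64 * (Real.sqrt P / η)) ^ 2 := by
          rw [mul_pow, div_pow, Real.sq_sqrt hP0.le]; ring
      _ ≤ _ := pow_le_pow_left₀ (by positivity) hKge 2
  have hinv : 1 / (K : ℝ) ^ 2 ≤ η ^ 2 / (4096 * P) := by
    rw [div_le_div_iff₀ (by positivity) (by positivity)]
    rw [div_le_iff₀ (by positivity)] at hK2
    linarith
  have hb1 : 32 * p / (K : ℝ) ^ 2 ≤ η ^ 2 / 128 := by
    calc 32 * p / (K : ℝ) ^ 2 ≤ 32 * P * (1 / (K : ℝ) ^ 2) := by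
          rw [mul_one_div]; gcongr
      _ ≤ 32 * P * (η ^ 2 / (4096 * P)) := mul_le_mul_of_nonneg_left hinv (by positivity)
      _ = η ^ 2 / 128 := by field_simp; norm_num
  have hb2 : 3 / (K : ℝ) ^ 4 ≤ η ^ 2 / 128 := by
    -- Outside the trivial case P ≥ η/2, which keeps the 1/K⁴ term as small as the other one.
    have h1 : η / P ≤ 2 := by rw [div_le_iff₀ hP0]; linarith
    calc 3 / (K : ℝ) ^ 4 = 3 * (1 / (K : ℝ) ^ 2) ^ 2 := by
          rw [div_pow, one_pow, ← pow_mul]; ring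
      _ ≤ 3 * (η ^ 2 / (4096 * P)) ^ 2 := by gcongr
      _ = 3 / 4096 ^ 2 * η ^ 2 * (η / P) ^ 2 := by field_simp
      _ ≤ 3 / 4096 ^ 2 * η ^ 2 * 2 ^ 2 := by gcongr
      _ ≤ η ^ 2 / 128 := by linarith [sq_nonneg η]
  change ∑ ω with ¬ |sqrtSum (β j) (T j) ^ 2 * 𝒜.output ω - X| ≤ N * η / 2,
      ‖𝒜.finalState O ω‖ ^ 2 ≤ 1 / 16
  have hηsq : 0 < η ^ 2 := by positivity
  set S := ∑ ω with ¬ |sqrtSum (β j) (T j) ^ 2 * 𝒜.output ω - X| ≤ N * η / 2,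
      ‖𝒜.finalState O ω‖ ^ 2
  by_contra hS
  push Not at hS
  have := mul_lt_mul_of_pos_left hS (by positivity : 0 < η ^ 2 / 4)
  linarith

/-! ### Amplification of the success probability -/

open Classical in
/-- A number close to more than half of the given ones, if there is one. -/
def vote (t : ℝ) {r : ℕ} (x : Fin r → ℝ) : ℝ :=
  if h : ∃ y, r < 2 * Finset.card {i | |x i - y| ≤ t} then h.choose else 0

-- Two strict majorities share an index, and the triangle inequality goes through that sample. The
-- true value a itself witnesses that the choice is possible.
open Classical in
theorem abs_vote_sub_le {t : ℝ} {r : ℕ} {x : Fin r → ℝ} {a : ℝ}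
    (ha : r < 2 * Finset.card {i | |x i - a| ≤ t}) : |vote t x - a| ≤ 2 * t := by
  have h : ∃ y, r < 2 * Finset.card {i | |x i - y| ≤ t} := ⟨a, ha⟩
  have hy := h.choose_spec
  rw [vote, dif_pos h]
  set y := h.choose
  have hcard := Finset.card_union_add_card_inter
    ({i | |x i - a| ≤ t} : Finset (Fin r)) ({i | |x i - y| ≤ t} : Finset (Fin r))
  have hle := Finset.card_le_univ
    (({i | |x i - a| ≤ t} : Finset (Fin r)) ∪ ({i | |x i - y| ≤ t} : Finset (Fin r)))
  rw [Fintype.card_fin] at hle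
  obtain ⟨i, hi⟩ := Finset.card_pos.1 (show 0 <
    Finset.card (({i | |x i - a| ≤ t} : Finset (Fin r)) ∩
      ({i | |x i - y| ≤ t} : Finset (Fin r))) by omega)
  simp only [Finset.mem_inter, Finset.mem_filter, Finset.mem_univ, true_and] at hi
  have := abs_sub_le y (x i) a
  rw [abs_sub_comm y (x i)] at this
  linarith [hi.1, hi.2]

open Classical in
/-- At least half of the given propositions hold. -/
def HalfHold {r : ℕ} (bad : Fin r → Prop) : Prop := r ≤ 2 * Finset.card {i | bad i}

open Classical in
theorem lt_two_mul_card_of_not_halfHold {r : ℕ} {good : Fin r → Prop}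
    (h : ¬ HalfHold fun i => ¬ good i) : r < 2 * Finset.card {i | good i} := by
  have hc : ∀ [DecidablePred good] [DecidablePred fun i => ¬ good i],
      Finset.card {i | good i} + Finset.card {i | ¬ good i} = r := by
    intro _ _
    rw [Finset.card_filter_add_card_filter_not, Finset.card_univ, Fintype.card_fin]
  have h2 := @hc (fun _ => Classical.propDecidable _) (fun _ => Classical.propDecidable _)
  rw [HalfHold, not_le] at h
  omega

open Classical in
/-- If an algorithm fails with probability at most `1/16`, then at least half of `r` independent
executions fail with probability at most `2 ^ (-r)`. -/
theorem sum_majority_failure_le {ι : Type} {D : ι → Type} [∀ o, Fintype (D o)]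
    [∀ o, DecidableEq (D o)] {κ : Type} [Fintype κ] [DecidableEq κ]
    (A : κ → QueryAlgorithm D) (r : ℕ)
    (output : (∀ a : κ × Fin r, (A a.1).Ω) → ℝ) (O : ∀ o, Matrix.unitaryGroup (D o) ℂ)
    (bad : ∀ j, (A j).Ω → Prop) (j : κ)
    (h : ∑ ω with bad j ω, ‖(A j).finalState O ω‖ ^ 2 ≤ 1 / 16) :
    ∑ ω : (∀ a : κ × Fin r, (A a.1).Ω) with HalfHold fun i => bad j (ω (j, i)),
      ‖(parallel (fun a : κ × Fin r => A a.1) output).finalState O ω‖ ^ 2 ≤ (1 / 2) ^ r := by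
  -- Exponential Markov inequality: each bad run of `j` has weight 16, so one run has expected
  -- weight at most 1 + 15/16 ≤ 2. If at least half are bad the total weight is at least 4^r, which
  -- leaves (2/4)^r.
  set f : ∀ a : κ × Fin r, (A a.1).Ω → ℝ := fun a ω => if a.1 = j ∧ bad a.1 ω then 16 else 1
    with hf
  have hf0 : ∀ a ω, 0 ≤ f a ω := fun a ω => by rw [hf]; positivity
  have hprod : ∀ ω : (∀ a : κ × Fin r, (A a.1).Ω),
      ∏ a, f a (ω a) = 16 ^ Finset.card {i | bad j (ω (j, i))} := by
    intro ω
    rw [Fintype.prod_prod_type, Finset.prod_eq_single j]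
    · simp only [hf, true_and]
      rw [Finset.prod_ite, Finset.prod_const, Finset.prod_const_one, mul_one]
    · intro b _ hb
      simp [hf, hb]
    · simp
  have hfactor : ∀ a : κ × Fin r, ∑ ω, ‖(A a.1).finalState O ω‖ ^ 2 * f a ω ≤
      if a.1 = j then 2 else 1 := by
    rintro ⟨b, i⟩
    have hone : ∑ ω, ‖(A b).finalState O ω‖ ^ 2 = 1 := nsq_finalState (A b) O
    by_cases hb : b = j
    · subst hb
      have : ∀ ω, ‖(A b).finalState O ω‖ ^ 2 * f (b, i) ω = ‖(A b).finalState O ω‖ ^ 2 +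
          15 * (if bad b ω then ‖(A b).finalState O ω‖ ^ 2 else 0) := by
        intro ω
        simp only [hf, true_and]
        split_ifs <;> ring
      simp only [this, Finset.sum_add_distrib, ← Finset.mul_sum, ← Finset.sum_filter, if_true]
      linarith
    · simp only [hf, hb, false_and, if_false, mul_one]
      exact hone.le
  have hexp : ∑ ω : (∀ a : κ × Fin r, (A a.1).Ω), ‖(parallel (fun a : κ × Fin r => A a.1) output).finalState O ω‖ ^ 2 *
      ∏ a, f a (ω a) ≤ 2 ^ r := by
    refine (sum_finalState_parallel (fun a : κ × Fin r => A a.1) output O f).trans_le ?_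
    refine (Finset.prod_le_prod (fun a _ => Finset.sum_nonneg fun ω _ =>
      mul_nonneg (by positivity) (hf0 a ω)) fun a _ => hfactor a).trans (le_of_eq ?_)
    rw [Fintype.prod_prod_type, Finset.prod_eq_single j]
    · simp
    · intro b _ hb
      simp [hb]
    · simp
  have hmarkov : (4 : ℝ) ^ r *
      ∑ ω : (∀ a : κ × Fin r, (A a.1).Ω) with HalfHold fun i => bad j (ω (j, i)),
        ‖(parallel (fun a : κ × Fin r => A a.1) output).finalState O ω‖ ^ 2 ≤ 2 ^ r := by
    refine le_trans ?_ hexp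
    rw [Finset.mul_sum]
    refine le_trans (Finset.sum_le_sum fun ω hω => ?_)
      (Finset.sum_le_sum_of_subset_of_nonneg (Finset.filter_subset _ _) fun ω _ _ =>
        mul_nonneg (by positivity) (Finset.prod_nonneg fun a _ => hf0 a _))
    rw [mul_comm, hprod]
    refine mul_le_mul_of_nonneg_left ?_ (by positivity)
    calc (4 : ℝ) ^ r ≤ 4 ^ (2 * Finset.card {i | bad j (ω (j, i))}) :=
          pow_le_pow_right₀ (by norm_num) (Finset.mem_filter.1 hω).2
      _ = 16 ^ Finset.card {i | bad j (ω (j, i))} := by rw [pow_mul]; norm_num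
  have h4 : (0 : ℝ) < 4 ^ r := by positivity
  rw [← mul_le_mul_iff_right₀ h4]
  refine hmarkov.trans (le_of_eq ?_)
  rw [← mul_pow]
  norm_num

open Classical in
theorem prob_ge_of_forall {ι κ : Type} [Fintype κ] {D : ι → Type} [∀ o, Fintype (D o)]
    [∀ o, DecidableEq (D o)] (𝒜 : QueryAlgorithm D) (O : ∀ o, Matrix.unitaryGroup (D o) ℂ)
    (S : Set ℝ) (fail : κ → 𝒜.Ω → Prop) {q : ℝ}
    (hfail : ∀ j, ∑ ω with fail j ω, ‖𝒜.finalState O ω‖ ^ 2 ≤ q)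
    (hS : ∀ ω, (∀ j, ¬ fail j ω) → 𝒜.output ω ∈ S) :
    1 - Fintype.card κ * q ≤ 𝒜.prob O S := by
  have hone : ∑ ω, ‖𝒜.finalState O ω‖ ^ 2 = 1 := nsq_finalState 𝒜 O
  have hsplit := Finset.sum_filter_add_sum_filter_not Finset.univ (fun ω => 𝒜.output ω ∈ S)
    fun ω => ‖𝒜.finalState O ω‖ ^ 2
  have hbad : ∑ ω with ¬ 𝒜.output ω ∈ S, ‖𝒜.finalState O ω‖ ^ 2 ≤ Fintype.card κ * q := by
    calc ∑ ω with ¬ 𝒜.output ω ∈ S, ‖𝒜.finalState O ω‖ ^ 2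
        ≤ ∑ ω, ∑ j, if fail j ω then ‖𝒜.finalState O ω‖ ^ 2 else 0 := by
          rw [Finset.sum_filter]
          refine Finset.sum_le_sum fun ω _ => ?_
          have hnn : ∀ j ∈ Finset.univ, 0 ≤ if fail j ω then ‖𝒜.finalState O ω‖ ^ 2 else 0 :=
            fun j _ => by positivity
          split_ifs with h
          · exact Finset.sum_nonneg hnn
          · by_cases hj : ∃ j, fail j ω
            · obtain ⟨j, hj⟩ := hj
              refine le_trans (le_of_eq ?_) (Finset.single_le_sum hnn (Finset.mem_univ j))
              rw [if_pos hj]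
            · exact absurd (hS ω fun j hf => hj ⟨j, hf⟩) h
      _ = ∑ j, ∑ ω with fail j ω, ‖𝒜.finalState O ω‖ ^ 2 := by
          rw [Finset.sum_comm]
          simp only [Finset.sum_filter]
      _ ≤ ∑ _j : κ, q := Finset.sum_le_sum fun j _ => hfail j
      _ = Fintype.card κ * q := by rw [Finset.sum_const, Finset.card_univ, nsmul_eq_mul]
  rw [hone] at hsplit
  change 1 - Fintype.card κ * q ≤ ∑ ω with 𝒜.output ω ∈ S, ‖𝒜.finalState O ω‖ ^ 2
  linarith

/-! ### Error shares, signs and the number of repetitions. -/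

theorem P0_le_quarter {μ : ℕ} (hμ : 1 ≤ μ) : P0 μ ≤ 1 / 4 := by
  have hμr : (1 : ℝ) ≤ μ := by exact_mod_cast hμ
  have h1 : Real.pi / (2 * (2 * (μ : ℝ) + 1)) ≤ Real.pi / 6 := by
    apply div_le_div_of_nonneg_left Real.pi_pos.le (by norm_num)
    linarith
  have h0 : 0 ≤ Real.pi / (2 * (2 * (μ : ℝ) + 1)) := by positivity
  have hpi := Real.pi_pos
  have h2 : Real.sin (Real.pi / (2 * (2 * (μ : ℝ) + 1))) ≤ 1 / 2 := by
    rw [← Real.sin_pi_div_six]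
    exact Real.sin_le_sin_of_le_of_le_pi_div_two (by linarith) (by linarith) h1
  have h3 : 0 ≤ Real.sin (Real.pi / (2 * (2 * (μ : ℝ) + 1))) :=
    Real.sin_nonneg_of_nonneg_of_le_pi h0 (by linarith)
  calc P0 μ ≤ (1 / 2) ^ 2 := pow_le_pow_left₀ h3 h2 2
    _ = 1 / 4 := by norm_num

theorem expVal_sum {n : ℕ} {κ : Type} (s : Finset κ) (ψ : Qubits n → ℂ)
    (M : κ → Matrix (Qubits n) (Qubits n) ℂ) :
    expVal ψ (∑ k ∈ s, M k) = ∑ k ∈ s, expVal ψ (M k) := by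
  simp only [expVal, Matrix.sum_mulVec, dotProduct_sum, Complex.re_sum]

theorem expVal_ofReal_smul {n : ℕ} (ψ : Qubits n → ℂ) (b : ℝ)
    (M : Matrix (Qubits n) (Qubits n) ℂ) : expVal ψ ((b : ℂ) • M) = b * expVal ψ M := by
  simp only [expVal, Matrix.smul_mulVec, dotProduct_smul, smul_eq_mul, Complex.re_ofReal_mul]

theorem normOneHalf_nonneg {J : ℕ} {m : Fin J → ℕ} (β : (j : Fin J) → Fin (m j) → ℝ) :
    0 ≤ normOneHalf β := Finset.sum_nonneg fun _ _ => sq_nonneg _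

open Classical in
/-- The common sign of the numbers in a family of constant sign. -/
def familySign {N : ℕ} (b : Fin N → ℝ) : ℝ := if ∀ k, 0 ≤ b k then 1 else -1

theorem abs_familySign {N : ℕ} (b : Fin N → ℝ) : |familySign b| = 1 := by
  rw [familySign]; split_ifs <;> simp

theorem familySign_mul_abs {N : ℕ} {b : Fin N → ℝ} (hb : (∀ k, 0 ≤ b k) ∨ ∀ k, b k ≤ 0)
    (k : Fin N) : familySign b * |b k| = b k := by
  rw [familySign]
  split_ifs with h
  · rw [abs_of_nonneg (h k), one_mul]
  · rw [abs_of_nonpos ((hb.resolve_left h) k), neg_one_mul, neg_neg]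

/-- Replacing the expectation values in `I` by the prior estimates, and the rest of the group by
an estimate `x`, changes the value of a group by at most its share of the error tolerance. -/
theorem abs_group_error_le {n J : ℕ} {m : Fin J → ℕ} {β : (j : Fin J) → Fin (m j) → ℝ}
    {I : (j : Fin J) → Finset (Fin (m j))} {C : (j : Fin J) → Fin (m j) → ℝ} {ε : ℝ}
    {Pr : (j : Fin J) → Fin (m j) → Matrix (Qubits n) (Qubits n) ℂ} {ψ : Qubits n → ℂ}
    (j : Fin J) (hε : 0 ≤ ε) (hβ : (∀ k, 0 ≤ β j k) ∨ ∀ k, β j k ≤ 0)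
    (hC : ∀ i ∈ I j, β j i ≠ 0 → |C j i - expVal ψ (Pr j i)| ≤ priorPrecision β I ε j) {x : ℝ}
    (hx : |x - remainingSum (β j) (I j) (Pr j) ψ| ≤
      ε / 2 * (sqrtSum (β j) Finset.univ ^ 2 / normOneHalf β)) :
    |(∑ i ∈ I j, β j i * C j i + familySign (β j) * x) -
        ∑ k, β j k * expVal ψ (Pr j k)| ≤
      ε * (sqrtSum (β j) Finset.univ ^ 2 / normOneHalf β) := by
  set share := sqrtSum (β j) Finset.univ ^ 2 / normOneHalf β with hshare
  have hshare0 : 0 ≤ share := div_nonneg (sq_nonneg _) (normOneHalf_nonneg β)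
  have hsplit : ∑ k, β j k * expVal ψ (Pr j k) = ∑ i ∈ I j, β j i * expVal ψ (Pr j i) +
      familySign (β j) * remainingSum (β j) (I j) (Pr j) ψ := by
    rw [← Finset.sum_add_sum_compl (I j), remainingSum, Finset.mul_sum]
    congr 1
    refine Finset.sum_congr rfl fun k _ => ?_
    rw [← mul_assoc, familySign_mul_abs hβ]
  have hprior : |∑ i ∈ I j, β j i * C j i - ∑ i ∈ I j, β j i * expVal ψ (Pr j i)| ≤
      ε / 2 * share := by
    rw [← Finset.sum_sub_distrib]
    have hterm : ∀ i ∈ I j, |β j i * C j i - β j i * expVal ψ (Pr j i)| ≤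
        |β j i| * priorPrecision β I ε j := by
      intro i hi
      rw [← mul_sub, abs_mul]
      by_cases h : β j i = 0
      · simp [h]
      · exact mul_le_mul_of_nonneg_left (hC i hi h) (abs_nonneg _)
    refine (Finset.abs_sum_le_sum_abs _ _).trans ((Finset.sum_le_sum hterm).trans ?_)
    rw [← Finset.sum_mul, priorPrecision, ← hshare]
    set s := ∑ i ∈ I j, |β j i| with hs
    -- The weight s cancels the denominator of the prior precision. If s = 0 the division convention
    -- is harmless, because the product vanishes.
    by_cases h : s = 0
    · rw [h, zero_mul]; positivity
    · refine le_of_eq ?_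
      field_simp
  rw [hsplit]
  have : (∑ i ∈ I j, β j i * C j i + familySign (β j) * x) -
      (∑ i ∈ I j, β j i * expVal ψ (Pr j i) +
        familySign (β j) * remainingSum (β j) (I j) (Pr j) ψ) =
      (∑ i ∈ I j, β j i * C j i - ∑ i ∈ I j, β j i * expVal ψ (Pr j i)) +
        familySign (β j) * (x - remainingSum (β j) (I j) (Pr j) ψ) := by ring
  rw [this]
  refine (abs_add_le _ _).trans ?_
  rw [abs_mul, abs_familySign, one_mul]
  linarith

/-- The number of repetitions for the failure probability `1 / x` is logarithmic. -/
theorem exists_repetitions {x : ℝ} (hx : 2 ≤ x) :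
    ∃ r : ℕ, x ≤ 2 ^ r ∧ (r : ℝ) ≤ 4 * Real.log x := by
  have hx0 : 0 < x := by linarith
  -- This bound gives both log x / log 2 ≤ 2 log x and 1 ≤ 2 log x, the latter paying for the
  -- rounding.
  have hlog2 : 1 / 2 < Real.log 2 := by linarith [Real.log_two_gt_d9]
  have hle : Real.log 2 ≤ Real.log x := Real.log_le_log (by norm_num) hx
  refine ⟨⌈Real.log x / Real.log 2⌉₊, ?_, ?_⟩
  · have h := Nat.le_ceil (Real.log x / Real.log 2)
    rw [div_le_iff₀ (by linarith)] at h
    rw [← Real.log_le_log_iff hx0 (by positivity), Real.log_pow]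
    exact h
  · have h := (Nat.ceil_lt_add_one
      (div_nonneg (by linarith) (by linarith) : 0 ≤ Real.log x / Real.log 2)).le
    have h1 : Real.log x / Real.log 2 ≤ 2 * Real.log x := by
      rw [div_le_iff₀ (by linarith)]
      have := mul_le_mul_of_nonneg_left hlog2.le (by linarith : 0 ≤ 2 * Real.log x)
      linarith
    linarith

end AAE

end

/-! ### The combined algorithm. -/

theorem mainTheorem3 :
    ∀ c : ℝ, 0 < c → ∃ K : ℝ, 0 < K ∧
      -- the classically known data
      ∀ (n J : ℕ) (_ : 0 < J) (m : Fin J → ℕ) (β : (j : Fin J) → Fin (m j) → ℝ)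
        (_ : ∀ j, (∀ k, 0 ≤ β j k) ∨ (∀ k, β j k ≤ 0))
        (I T : (j : Fin J) → Finset (Fin (m j))) (_ : ∀ j, (I j)ᶜ ⊆ T j)
        (C : (j : Fin J) → Fin (m j) → ℝ) (μ : Fin J → ℕ) (_ : ∀ j, 1 ≤ μ j)
        (ε δ' : ℝ) (_ : 0 < ε) (_ : 0 < δ') (_ : δ' < 1) (_ : 2 * δ' ≤ J),
      ∃ 𝒜 : AAE.QueryAlgorithm (AAE.Register n m),
        -- the unknown projectors, state, oracles and deviations
        ∀ (Pr : (j : Fin J) → Fin (m j) → Matrix (AAE.Qubits n) (AAE.Qubits n) ℂ)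
          (ψ : AAE.Qubits n → ℂ)
          (O : ∀ o : AAE.OracleName J, Matrix.unitaryGroup (AAE.Register n m o) ℂ)
          (δ : Fin J → ℝ),
        (∀ j k, IsStarProjection (Pr j k)) →
        AAE.IsAccess β T Pr ψ O →
        (∀ j, ∀ i ∈ I j, β j i ≠ 0 →
          0 < C j i ∧ AAE.priorPrecision β I ε j ≤ C j i ∧
            |C j i - AAE.expVal ψ (Pr j i)| ≤ AAE.priorPrecision β I ε j) →
        (∀ j, AAE.remainingProb β I Pr ψ j = AAE.P0 (μ j) + δ j ∧
          -AAE.P0 (μ j) ≤ δ j ∧ δ j < 0) →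
        ε ≤ c * (AAE.normOneHalf β * ⨅ j, AAE.P0 (μ j) ^ 2 / |δ j|) →
        1 - δ' ≤ 𝒜.prob O
            {a | |a - AAE.expVal ψ (∑ j, ∑ k, (β j k : ℂ) • Pr j k)| ≤ ε} ∧
          (𝒜.numQueries : ℝ) ≤
            K * ((∑ j, Real.sqrt (AAE.P0 (μ j))) * AAE.normOneHalf β * Real.log (J / δ') / ε *
              ⨆ j, AAE.P0 (μ j) / |δ j|) := by
  open AAE in
  intro c _
  -- 32768 = 4 · 2 · 4096: the repetitions, the 2 in 1/η = 2‖β‖/ε, and the cost of one group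
  -- estimate.
  refine ⟨32768, by norm_num, ?_⟩
  intro n J hJ m β hβ I T hIT C μ hμ ε δ' hε hδ0 _ hδJ
  -- If all coefficients vanish, this is 0 by the division convention; positivity is needed only for
  -- groups that load a nonzero term.
  set η : ℝ := ε / (2 * normOneHalf β) with hη
  have hnorm := normOneHalf_nonneg β
  have hη0 : 0 ≤ η := by positivity
  have hηpos : ∀ j, sqrtSum (β j) (T j) ≠ 0 → 0 < η := by
    intro j hj
    have h1 : 0 < sqrtSum (β j) Finset.univ :=
      (lt_of_le_of_ne (sqrtSum_nonneg _ _) (Ne.symm hj)).trans_le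
        (sqrtSum_mono _ (Finset.subset_univ _))
    have h2 : 0 < normOneHalf β := lt_of_lt_of_le (by positivity)
      (Finset.single_le_sum (f := fun j => sqrtSum (β j) Finset.univ ^ 2)
        (fun _ _ => sq_nonneg _) (Finset.mem_univ j))
    positivity
  choose A hAq hAfail using fun j => exists_groupEstimator β I T j (hIT j)
    (P0_le_quarter (hμ j)) hη0 (hηpos j)
  have hx2 : 2 ≤ (J : ℝ) / δ' := by rw [le_div_iff₀ hδ0]; exact hδJ
  obtain ⟨r, hr, hrlog⟩ := exists_repetitions hx2
  -- Voting doubles the tolerance, and 2t is exactly ε/2 times the share of the group.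
  let t : Fin J → ℝ := fun j => sqrtSum (β j) Finset.univ ^ 2 * η / 2
  let output : (∀ a : Fin J × Fin r, (A a.1).Ω) → ℝ := fun ω =>
    ∑ j, (∑ i ∈ I j, β j i * C j i +
      familySign (β j) * vote (t j) fun i => (A j).output (ω (j, i)))
  refine ⟨parallel (fun a : Fin J × Fin r => A a.1) output, ?_⟩
  intro Pr ψ O δ hPr hO hC hδ _
  have hXle : ∀ j, remainingSum (β j) (I j) (Pr j) ψ ≤ sqrtSum (β j) (I j)ᶜ ^ 2 * P0 (μ j) := by
    intro j
    by_cases h : sqrtSum (β j) (I j)ᶜ = 0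
    · have : remainingSum (β j) (I j) (Pr j) ψ = 0 :=
        Finset.sum_eq_zero fun k hk => by
          rw [eq_zero_of_sqrtSum_eq_zero h hk]; simp
      rw [this, h]; simp
    · have h1 : remainingProb β I Pr ψ j ≤ P0 (μ j) := by linarith [(hδ j).1, (hδ j).2.2]
      rw [remainingProb, div_le_iff₀ (by positivity)] at h1
      rw [mul_comm]
      exact h1
  constructor
  · have hq : 1 - δ' ≤ 1 - Fintype.card (Fin J) * (1 / 2 : ℝ) ^ r := by
      rw [Fintype.card_fin, one_div, inv_pow, ← div_eq_mul_inv]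
      rw [div_le_iff₀ hδ0] at hr
      have : (J : ℝ) / 2 ^ r ≤ δ' := by
        rw [div_le_iff₀ (by positivity), mul_comm]; exact hr
      linarith
    refine hq.trans (prob_ge_of_forall _ O _
      (fun (j : Fin J) (ω : ∀ a : Fin J × Fin r, (A a.1).Ω) => HalfHold fun i =>
        ¬ |(A j).output (ω (j, i)) - remainingSum (β j) (I j) (Pr j) ψ| ≤ t j)
      (fun j => ?_) fun ω hω => ?_)
    · refine sum_majority_failure_le A r output O
        (fun j ω => ¬ |(A j).output ω - remainingSum (β j) (I j) (Pr j) ψ| ≤ t j) j ?_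
      convert hAfail j Pr ψ O hPr hO (hXle j)
    · have hvote : ∀ j, |vote (t j) (fun i => (A j).output (ω (j, i))) -
          remainingSum (β j) (I j) (Pr j) ψ| ≤ 2 * t j :=
        fun j => abs_vote_sub_le (lt_two_mul_card_of_not_halfHold (hω j))
      have hshare : ∀ j, 2 * t j =
          ε / 2 * (sqrtSum (β j) Finset.univ ^ 2 / normOneHalf β) := by
        intro j
        simp only [t, hη]
        rw [← div_div]
        ring
      change |output ω - expVal ψ (∑ j, ∑ k, (β j k : ℂ) • Pr j k)| ≤ ε
      simp only [output, expVal_sum, expVal_ofReal_smul]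
      rw [← Finset.sum_sub_distrib]
      refine (Finset.abs_sum_le_sum_abs _ _).trans ((Finset.sum_le_sum fun j _ =>
        abs_group_error_le j hε.le (hβ j) (fun i hi h => (hC j i hi h).2.2)
          ((hvote j).trans_eq (hshare j))).trans ?_)
      rw [← Finset.mul_sum, ← Finset.sum_div]
      -- The shares add up to ‖β‖/‖β‖, which is 1, or 0 if every coefficient vanishes.
      exact mul_le_of_le_one_right hε.le (div_self_le_one _)
  · have hsup : 1 ≤ ⨆ j, P0 (μ j) / |δ j| := by
      refine le_trans ?_ (le_ciSup (Set.finite_range _).bddAbove (⟨0, hJ⟩ : Fin J))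
      obtain ⟨_, h1, h2⟩ := hδ ⟨0, hJ⟩
      rw [abs_of_neg h2, one_le_div (by linarith)]
      linarith
    have hlog : 0 ≤ Real.log (J / δ') := Real.log_nonneg (by linarith)
    have hsum : 0 ≤ ∑ j, Real.sqrt (P0 (μ j)) :=
      Finset.sum_nonneg fun _ _ => Real.sqrt_nonneg _
    have hcost : ((parallel (fun a : Fin J × Fin r => A a.1) output).numQueries : ℝ) =
        r * ∑ j, ((A j).numQueries : ℝ) := by
      rw [numQueries_parallel, Fintype.sum_prod_type]
      push_cast
      simp [Finset.mul_sum]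
    calc ((parallel (fun a : Fin J × Fin r => A a.1) output).numQueries : ℝ)
        = r * ∑ j, ((A j).numQueries : ℝ) := hcost
      _ ≤ r * ∑ j, 4096 * (Real.sqrt (P0 (μ j)) / η) :=
          mul_le_mul_of_nonneg_left (Finset.sum_le_sum fun j _ => hAq j) (by positivity)
      _ = r * (8192 * ((∑ j, Real.sqrt (P0 (μ j))) * normOneHalf β / ε)) := by
          rw [← Finset.mul_sum, ← Finset.sum_div, hη, div_div_eq_mul_div]
          ring
      _ ≤ (4 * Real.log (J / δ')) *
            (8192 * ((∑ j, Real.sqrt (P0 (μ j))) * normOneHalf β / ε)) :=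
          mul_le_mul_of_nonneg_right hrlog (by positivity)
      _ = 32768 * ((∑ j, Real.sqrt (P0 (μ j))) * normOneHalf β * Real.log (J / δ') / ε * 1) := by
          ring
      _ ≤ _ := by gcongr
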